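/- **Rank-one transformations.** Let $r_n\ge 1$ and $s_{n,i}\ge 0$ ($0\le i\le r_n$) be integers. A rank-one transformation $T$ with these parameters is built by cutting and stacking. The first column is the single interval $[0,1)$. Given a column, i.e. a finite stack of pairwise disjoint intervals (levels) of equal length, cut it vertically into $r_n+1$ subcolumns of equal width, put $s_{n,i}$ new intervals (spacers) of that width on top of the $i$-th subcolumn (numbered from the left, starting with $0$), taking consecutive intervals immediately to the right of the column, and stack the subcolumns with their spacers, right on top of left, to obtain the next column. $T$ maps each level of each column, except the top one, by translation onto the level directly above it. It is defined on the union $Y\subseteq[0,\infty)$ of all columns, with Lebesgue measure; if $Y$ has finite measure, the measure is normalized to a probability measure. A transformation $T$ preserving a probability measure is weakly mixing if $T\times T$ is ergodic. **Theorem 5.1.** Let $T$ be a rank-one transformation with parameters $r_n, s_{n,i}$, and suppose there is $\kappa>0$ such that for all sufficiently large $n$, $$|\{0\le i<r_n : s_{n,i}=0\}|\ge \kappa (r_n+1)\quad\text{and}\quad |\{0\le i<r_n : s_{n,i}=1\}|\ge \kappa (r_n+1).$$ 1. If the spacers are bounded, i.e. there is $k$ such that $s_{n,i}\le k$ for all $n$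 and all $0\le i\le r_n$, then $Y$ has finite measure and $T$ is weakly mixing. 2. If there is $k$ such that $s_{n,i}\le k$ for all $n$ and all $0\le i<r_n$ only, and $Y$ has finite measure, then $T$ is weakly mixing. **Corollary 5.8.** Let $L_n>1$ and $\gamma_n>1$ be integers with $\limsup_n\gamma_n<\infty$. Define words over $\{0,1\}$ by $B_1=0$ and $$B_{n+1}=\big((B_n1)^{\gamma_n}B_n\big)^{L_n},$$ i.e. $B_{n+1}=\prod_{i=0}^{r_n}B_n1^{s_{n,i}}$ with $r_n+1=L_n(\gamma_n+1)$, and $s_{n,i}=0$ if $i\equiv\gamma_n \pmod{\gamma_n+1}$, $s_{n,i}=1$ otherwise. Then: 1. The rank-one transformation with the parameters $r_n,s_{n,i}$ lives on a space of finite measure and is weakly mixing. 2. Let $X$ be the set of all $x\in\{0,1\}^{\mathbb Z}$ such that every finite subword of $x$ is a subword of some $B_n$. There is exactly one probability measure $\nu$ on $X$ (the empirical measure) such that for every word $w$ and every $a\in\mathbb Z$ the set of $x\in X$ in which $w$ occurs at position $a$ has measure $$\lim_{n\to\infty}\frac{|\{1\le j\le |B_n|-|w| : w\text{ occurs in }B_n\text{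 at position }j\}|}{|B_n|-|w|},$$ and the shift on $X$ is weakly mixing for $\nu$. -/

import Mathlib

open Filter MeasureTheory Topology ProbabilityTheory
open scoped ENNReal

/-- The parameters of a cutting-and-stacking construction: at stage `n` the column is cut `r n ≥ 1`
times, giving `r n + 1` subcolumns numbered `0, …, r n` from left to right, and `s n i` spacers
are put on top of subcolumn `i`. Only the values `s n i` with `i ≤ r n` are ever used.
Stages are numbered from `0`. -/
structure RankOneData where
  r : ℕ → ℕ
  s : ℕ → ℕ → ℕ
  one_le_r : ∀ n, 1 ≤ r n

namespace RankOneData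

variable (R : RankOneData)

/-- The common length of the levels of the `n`-th column. -/
noncomputable def width : ℕ → ℝ
  | 0 => 1
  | n + 1 => width n / (R.r n + 1)

/-- The left endpoints of the levels of the `n`-th column, listed from bottom to top. The initial
column is `[0, 1)`. The `n`-th column occupies `[0, h * width n)`, `h` being its height; subcolumn
`i` consists of the `i`-th subintervals of its levels; the new spacers are the consecutive intervals
of length `width (n + 1)` to the right of the column, and the subcolumns with their spacers
are stacked, right on top of left. -/
noncomputable def levels : ℕ → List ℝ
  | 0 => [0]
  | n + 1 => (List.range (R.r n + 1)).flatMap fun i : ℕ =>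
      (levels n).map (fun a => a + i * R.width (n + 1)) ++
        (List.range (R.s n i)).map fun m : ℕ =>
          (levels n).length * R.width n
            + (((∑ i' ∈ Finset.range i, R.s n i' : ℕ) : ℝ) + m) * R.width (n + 1)

/-- The height of the `n`-th column. -/
noncomputable def height (n : ℕ) : ℕ := (R.levels n).length

/-- The left endpoint of the level at height `j` of the `n`-th column (for `j < height n`). -/
noncomputable def base (n j : ℕ) : ℝ := (R.levels n).getD j 0

/-- The level at height `j` of the `n`-th column (for `j < height n`). -/
def level (n j : ℕ) : Set ℝ := Set.Ico (R.base n j) (R.base n j + R.width n)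

/-- The union of the levels of the `n`-th column. -/
def column (n : ℕ) : Set ℝ := ⋃ j ∈ Finset.range (R.height n), R.level n j

/-- The space on which the transformation lives: the union of all the columns. -/
def space : Set ℝ := ⋃ n, R.column n

open Classical in
/-- The rank-one transformation: on each level of a column except the top one, it is the translation
onto the level directly above. (The choice below is irrelevant, see `map_eq`; outside `space` the map
is the identity.) -/
noncomputable def map (x : ℝ) : ℝ :=
  if h : ∃ p : ℕ × ℕ, p.2 + 1 < R.height p.1 ∧ x ∈ R.level p.1 p.2 then
    x + (R.base h.choose.1 (h.choose.2 + 1) - R.base h.choose.1 h.choose.2)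
  else x

theorem width_pos (n : ℕ) : 0 < R.width n := by
  induction n with
  | zero => simp [width]
  | succ n ih => rw [width]; positivity

theorem width_eq (n : ℕ) : R.width n = (R.r n + 1) * R.width (n + 1) := by
  rw [width]
  field_simp

theorem levels_grid (n : ℕ) :
    (∀ a ∈ R.levels n, ∃ k : ℕ, k < (R.levels n).length ∧ a = k * R.width n) ∧
      (R.levels n).Nodup := by
  induction n with
  | zero => simp [levels]
  | succ n ih =>
    obtain ⟨ih1, ih2⟩ := ih
    have hw := R.width_pos (n + 1)
    have hwn := R.width_eq n
    have key : ∀ k k' : ℕ, (k : ℝ) * R.width (n + 1) = k' * R.width (n + 1) → k = k' := by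
      intro k k' h
      exact_mod_cast mul_right_cancel₀ hw.ne' h
    have hlen : (R.levels (n + 1)).length =
        (R.levels n).length * (R.r n + 1) + ∑ i ∈ Finset.range (R.r n + 1), R.s n i := by
      rw [levels, List.length_flatMap]
      generalize R.r n + 1 = l
      induction l with
      | zero => simp
      | succ l ihl =>
        rw [List.range_succ, List.map_append, List.sum_append, ihl, Finset.sum_range_succ]
        simp
        ring
    have hsum : ∀ i i' : ℕ, i < i' → ∑ x ∈ Finset.range i, R.s n x + R.s n i ≤
        ∑ x ∈ Finset.range i', R.s n x := by
      intro i i' h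
      rw [← Finset.sum_range_succ]
      exact Finset.sum_le_sum_of_subset (Finset.range_mono h)
    have old : ∀ a ∈ R.levels n, ∀ i : ℕ, ∃ k : ℕ, k < (R.levels n).length ∧
        a + i * R.width (n + 1) = ((k * (R.r n + 1) + i : ℕ) : ℝ) * R.width (n + 1) := by
      intro a ha i
      obtain ⟨k, hk, rfl⟩ := ih1 a ha
      refine ⟨k, hk, ?_⟩
      rw [hwn]
      push_cast
      ring
    have new : ∀ i m : ℕ, ((R.levels n).length * R.width n
            + (((∑ i' ∈ Finset.range i, R.s n i' : ℕ) : ℝ) + m) * R.width (n + 1)) =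
        (((R.levels n).length * (R.r n + 1) + ∑ i' ∈ Finset.range i, R.s n i' + m : ℕ) : ℝ)
          * R.width (n + 1) := by
      intro i m
      rw [hwn]
      push_cast
      ring
    have small : ∀ k i : ℕ, k < (R.levels n).length → i < R.r n + 1 →
        k * (R.r n + 1) + i < (R.levels n).length * (R.r n + 1) := by
      intro k i hk hi
      calc k * (R.r n + 1) + i < (k + 1) * (R.r n + 1) := by rw [Nat.succ_mul]; omega
        _ ≤ _ := Nat.mul_le_mul_right _ hk
    refine ⟨?_, ?_⟩
    · intro a ha
      rw [hlen]
      simp only [levels, List.mem_flatMap, List.mem_range, List.mem_append, List.mem_map] at ha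
      obtain ⟨i, hi, ⟨b, hb, rfl⟩ | ⟨m, hm, rfl⟩⟩ := ha
      · obtain ⟨k, hk, h⟩ := old b hb i
        exact ⟨_, (small k i hk hi).trans_le (Nat.le_add_right _ _), h⟩
      · refine ⟨_, ?_, new i m⟩
        have := hsum i (R.r n + 1) hi
        omega
    · rw [levels, List.nodup_flatMap]
      refine ⟨?_, ?_⟩
      · intro i hi
        rw [List.mem_range] at hi
        refine List.Nodup.append (ih2.map fun a b h => by simpa using h)
          (List.nodup_range.map fun m m' h => ?_) ?_
        · simp only [new] at h
          have := key _ _ h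
          omega
        · intro x hx hx'
          simp only [List.mem_map, List.mem_range] at hx hx'
          obtain ⟨b, hb, rfl⟩ := hx
          obtain ⟨m, hm, h⟩ := hx'
          obtain ⟨k, hk, h'⟩ := old b hb i
          rw [new, h'] at h
          have := key _ _ h
          have := small k i hk hi
          omega
      · refine List.Pairwise.imp_of_mem ?_ (List.pairwise_lt_range (n := R.r n + 1))
        intro i i' hi hi' hii
        rw [List.mem_range] at hi hi'
        intro x hx hx'
        simp only [List.mem_append, List.mem_map, List.mem_range] at hx hx'
        obtain ⟨b, hb, rfl⟩ | ⟨m, hm, rfl⟩ := hx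
        · obtain ⟨k, hk, h⟩ := old b hb i
          obtain ⟨b', hb', h'⟩ | ⟨m', hm', h'⟩ := hx'
          · obtain ⟨k', hk', h''⟩ := old b' hb' i'
            rw [h, h''] at h'
            have e := congrArg (· % (R.r n + 1)) (key _ _ h')
            simp only [Nat.mul_add_mod_self_right, Nat.mod_eq_of_lt hi, Nat.mod_eq_of_lt hi'] at e
            omega
          · rw [new, h] at h'
            have := key _ _ h'
            have := small k i hk hi
            omega
        · obtain ⟨b', hb', h'⟩ | ⟨m', hm', h'⟩ := hx'
          · obtain ⟨k', hk', h''⟩ := old b' hb' i'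
            rw [new, h''] at h'
            have := key _ _ h'
            have := small k' i' hk' hi'
            omega
          · rw [new, new] at h'
            have := key _ _ h'
            have := hsum i i' hii
            omega

/-- Level `a` is directly below level `b` in the `n`-th column, and `x` lies in `a`. -/
def Below (n : ℕ) (x a b : ℝ) : Prop :=
  [a, b] <:+: R.levels n ∧ a ≤ x ∧ x < a + R.width n

theorem Below.unique {R : RankOneData} {n : ℕ} {x a b a' b' : ℝ} (h : R.Below n x a b)
    (h' : R.Below n x a' b') : a = a' ∧ b = b' := by
  obtain ⟨g, nd⟩ := R.levels_grid n
  have hw := R.width_pos n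
  obtain ⟨hi, h1, h2⟩ := h
  obtain ⟨hi', h1', h2'⟩ := h'
  obtain ⟨k, -, hk⟩ := g a (hi.subset (by simp))
  obtain ⟨k', -, hk'⟩ := g a' (hi'.subset (by simp))
  have hkk : k = k' := by
    have e1 : (k : ℝ) < k' + 1 := by
      by_contra hc
      push Not at hc
      nlinarith
    have e2 : (k' : ℝ) < k + 1 := by
      by_contra hc
      push Not at hc
      nlinarith
    have e1' : k < k' + 1 := by exact_mod_cast e1
    have e2' : k' < k + 1 := by exact_mod_cast e2
    omega
  have haa : a = a' := by rw [hk, hk', hkk]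
  refine ⟨haa, ?_⟩
  subst haa
  obtain ⟨p, q, e⟩ := hi
  obtain ⟨p', q', e'⟩ := hi'
  have l1 : (R.levels n)[p.length]? = some a := by rw [← e]; simp
  have l2 : (R.levels n)[p'.length]? = some a := by rw [← e']; simp
  have l3 : (R.levels n)[p.length + 1]? = some b := by rw [← e]; simp
  have l4 : (R.levels n)[p'.length + 1]? = some b' := by rw [← e']; simp
  have hlt : p.length < (R.levels n).length := by rw [← e]; simp
  have := (List.nodup_iff_getElem?_ne_getElem?.mp nd)
  have hpp : p.length = p'.length := by
    by_contra hne
    have hlt' : p'.length < (R.levels n).length := by rw [← e']; simp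
    rcases Nat.lt_or_gt_of_ne hne with hl | hl
    · exact this _ _ hl hlt' (l1.trans l2.symm)
    · exact this _ _ hl hlt (l2.trans l1.symm)
  rw [hpp, l4] at l3
  exact (Option.some.inj l3).symm

theorem Below.succ {R : RankOneData} {n : ℕ} {x a b : ℝ} (h : R.Below n x a b) :
    ∃ a' b', R.Below (n + 1) x a' b' ∧ b' - a' = b - a := by
  obtain ⟨hi, h1, h2⟩ := h
  have hw := R.width_pos (n + 1)
  have hwn := R.width_eq n
  set i := ⌊(x - a) / R.width (n + 1)⌋₊ with hidef
  have hnn : 0 ≤ (x - a) / R.width (n + 1) := div_nonneg (by linarith) hw.le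
  have f1 : (i : ℝ) * R.width (n + 1) ≤ x - a := by
    rw [← le_div_iff₀ hw]; exact Nat.floor_le hnn
  have f2 : x - a < (i + 1) * R.width (n + 1) := by
    rw [← div_lt_iff₀ hw]; exact Nat.lt_floor_add_one _
  have hir : i < R.r n + 1 := by
    have : (i : ℝ) < R.r n + 1 := by
      by_contra hc
      push Not at hc
      nlinarith
    exact_mod_cast this
  refine ⟨a + i * R.width (n + 1), b + i * R.width (n + 1), ⟨?_, by linarith, by linarith⟩, by ring⟩
  rw [levels]
  refine List.IsInfix.trans ?_ (List.infix_of_mem_flatten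
    (List.mem_map.mpr ⟨i, List.mem_range.mpr hir, rfl⟩))
  refine List.IsInfix.trans ?_ (List.prefix_append _ _).isInfix
  exact hi.map (fun a => a + i * R.width (n + 1))

theorem Below.mono {R : RankOneData} {n m : ℕ} (hnm : n ≤ m) {x a b : ℝ} (h : R.Below n x a b) :
    ∃ a' b', R.Below m x a' b' ∧ b' - a' = b - a := by
  induction m, hnm using Nat.le_induction with
  | base => exact ⟨a, b, h, rfl⟩
  | succ m _ ih =>
    obtain ⟨a', b', h', e⟩ := ih
    obtain ⟨a'', b'', h'', e'⟩ := h'.succ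
    exact ⟨a'', b'', h'', e'.trans e⟩

theorem below_base {n j : ℕ} (hj : j + 1 < R.height n) {x : ℝ} (hx : x ∈ R.level n j) :
    R.Below n x (R.base n j) (R.base n (j + 1)) := by
  refine ⟨?_, hx.1, hx.2⟩
  unfold height at hj
  refine ⟨(R.levels n).take j, (R.levels n).drop (j + 2), ?_⟩
  have e1 : R.base n j = (R.levels n)[j] := by simp [base, show j < (R.levels n).length by omega]
  have e2 : R.base n (j + 1) = (R.levels n)[j + 1] := by simp [base, hj]
  rw [e1, e2, List.append_assoc]
  conv_rhs => rw [← List.take_append_drop j (R.levels n)]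
  rw [List.drop_eq_getElem_cons (by omega : j < _), List.drop_eq_getElem_cons hj]
  rfl

/-- On every level of every column except the top one, `map` is the translation onto the level
directly above. -/
theorem map_eq {n j : ℕ} (hj : j + 1 < R.height n) {x : ℝ} (hx : x ∈ R.level n j) :
    R.map x = x + (R.base n (j + 1) - R.base n j) := by
  have h : ∃ p : ℕ × ℕ, p.2 + 1 < R.height p.1 ∧ x ∈ R.level p.1 p.2 := ⟨(n, j), hj, hx⟩
  rw [map, dif_pos h]
  obtain ⟨c1, c2⟩ := h.choose_spec
  obtain ⟨a, b, h1, e1⟩ := (R.below_base c1 c2).mono (le_max_left _ n)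
  obtain ⟨a', b', h2, e2⟩ := (R.below_base hj hx).mono (le_max_right h.choose.1 n)
  obtain ⟨rfl, rfl⟩ := h1.unique h2
  rw [← e1, ← e2]

/-- Lebesgue measure on `space`, normalized to total mass one (when `space` has finite measure). -/
noncomputable def measure : Measure ℝ := volume[|R.space]

/-- The words coding the columns: `0` stands for the initial column, `1` for the spacers. -/
def word : ℕ → List (Fin 2)
  | 0 => [0]
  | n + 1 => (List.range (R.r n + 1)).flatMap fun i => word n ++ List.replicate (R.s n i) 1

/-- The associated subshift: all biinfinite sequences each of whose finite subwords is a subword of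
one of the words `word n`. -/
def subshift : Set (ℤ → Fin 2) :=
  {x | ∀ (a : ℤ) (l : ℕ), ∃ n, List.ofFn (fun i : Fin l => x (a + (i : ℕ))) <:+: R.word n}

/-- The shift on the associated subshift. -/
def shift (x : R.subshift) : R.subshift :=
  ⟨fun m => x.1 (m + 1), fun a l => by
    obtain ⟨n, hn⟩ := x.2 (a + 1) l
    refine ⟨n, ?_⟩
    have h : (fun i : Fin l => x.1 (a + (i : ℕ) + 1)) = fun i : Fin l => x.1 (a + 1 + (i : ℕ)) := by
      funext i
      rw [add_right_comm]
    simpa only [h] using hn⟩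

/-- The cylinder of sequences in the subshift that show the word `w` from position `a` on. -/
def cylinder (w : List (Fin 2)) (a : ℤ) : Set R.subshift :=
  {x | ∀ i : Fin w.length, x.1 (a + (i : ℕ)) = w.get i}

/-- The number of starting positions `0 ≤ j < len B - len w` of occurrences of `w` in `B`. -/
def occurrences (w B : List (Fin 2)) : ℕ :=
  ((Finset.range (B.length - w.length)).filter fun j => w <+: B.drop j).card

/-- `ν` is the empirical measure of the subshift: the measure of the cylinder of a word (at any
position) is the limit of the frequencies of the word in the words `word n`. -/
structure IsEmpiricalMeasure (ν : Measure R.subshift) : Prop where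
  isProbabilityMeasure : IsProbabilityMeasure ν
  tendsto : ∀ (w : List (Fin 2)) (a : ℤ),
    Tendsto (fun n => (occurrences w (R.word n) : ℝ) / ((R.word n).length - w.length : ℝ))
      atTop (𝓝 (ν.real (R.cylinder w a)))

/-- The parameters with `B (n + 1) = ((B n 1)^(γ n) B n)^(L n)`, where `B n` is the `n`-th word
(see `word_family_succ`). -/
def family (L γ : ℕ → ℕ) (hL : ∀ n, 1 < L n) (hγ : ∀ n, 1 < γ n) : RankOneData where
  r n := L n * (γ n + 1) - 1
  s n i := if i % (γ n + 1) = γ n then 0 else 1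
  one_le_r n := by
    have h1 := hL n
    have h2 := hγ n
    have : 2 * 3 ≤ L n * (γ n + 1) := Nat.mul_le_mul (by omega) (by omega)
    omega

theorem word_family_succ (L γ : ℕ → ℕ) (hL : ∀ n, 1 < L n) (hγ : ∀ n, 1 < γ n) (n : ℕ) :
    (family L γ hL hγ).word (n + 1) =
      (List.replicate (L n)
        ((List.replicate (γ n) ((family L γ hL hγ).word n ++ [1])).flatten
          ++ (family L γ hL hγ).word n)).flatten := by
  generalize hB : (family L γ hL hγ).word n = B
  have hr : L n * (γ n + 1) - 1 + 1 = L n * (γ n + 1) :=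
    Nat.sub_add_cancel (Nat.mul_pos (by have := hL n; omega) (by omega))
  simp only [word, hB]
  simp only [family, hr]
  have inner : ∀ (g m : ℕ), m ≤ g → (List.range m).flatMap
      (fun i => B ++ List.replicate (if i % (g + 1) = g then 0 else 1) 1)
      = (List.replicate m (B ++ [1])).flatten := by
    intro g m
    induction m with
    | zero => simp
    | succ m ih =>
      intro hm
      have h1 : m % (g + 1) = m := Nat.mod_eq_of_lt (by omega)
      have h2 : m ≠ g := by omega
      rw [List.range_succ, List.flatMap_append, ih (by omega), List.replicate_succ',
        List.flatten_append]
      simp [h1, h2]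
  have block : ∀ g : ℕ, (List.range (g + 1)).flatMap
      (fun i => B ++ List.replicate (if i % (g + 1) = g then 0 else 1) 1)
      = (List.replicate g (B ++ [1])).flatten ++ B := by
    intro g
    rw [List.range_succ, List.flatMap_append, inner g g le_rfl]
    simp
  generalize L n = l
  induction l with
  | zero => simp
  | succ l ih =>
    rw [Nat.succ_mul, List.range_add, List.flatMap_append, ih, List.replicate_succ',
      List.flatten_append, List.flatMap_map]
    simp only [Nat.mul_add_mod_self_right]
    rw [block]
    simp

end RankOneData

/-- A map `T` is weakly mixing for the probability measure `μ` if it preserves `μ` and `T × T` is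
ergodic for the product measure. -/
structure IsWeaklyMixing {Y : Type*} [MeasurableSpace Y] (T : Y → Y) (μ : Measure Y) : Prop where
  isProbabilityMeasure : IsProbabilityMeasure μ
  measurePreserving : MeasurePreserving T μ μ
  ergodic_prod : Ergodic (Prod.map T T) (μ.prod μ)

/-! Let `A` be invariant under T × T, let h be the height of column n and w the width of column n +
1. If s spacers follow a subcolumn other than the last, T^(h+s) carries it to the next subcolumn by
translation by w (`iterate_map_subcolumn`). Let E be the product of the union of the subcolumns with
s = 0 and the union of those with s = 1. On E the map T^h × T^(h+1) is translation by (w, w), so (x,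
T y) ∈ A iff (x + w, y + w) ∈ A (`mem_iff_add_mem`). Now `A` is nearly a union of boxes, i.e.
products of two levels of column n, and this translation keeps points of E in their boxes. Hence `A`
and its preimage under id × T nearly agree on E. As E fills at least the proportion κ² of every box,
and the symmetric difference is itself nearly a union of boxes, it is null (`sq_symmDiff_eq_zero`).

Thus `A` is also invariant under id × T up to a null set. Together with T × T this links any two
boxes of a column, so `A` has the same measure in all of them (`sq_inter_box_eq`). Boxes exhaust
open sets, so `A` has the same density in all open sets of positive measure; open sets shrinking to
`A` force it to be null or conull (`ergodic_prod`). Bounded spacers make the space finite because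
the widths are summable.

For the subshift, almost every point is coded by the symbols of the levels its orbit visits. The
coding intertwines T with the shift, so the image measure is weakly mixing
(`IsWeaklyMixing.factor`). Counting levels shows that it gives cylinders the limiting frequencies
(`tendsto_frequency`), and cylinders determine a measure (`IsEmpiricalMeasure.unique`). -/

theorem List.flatMap_range_getD {α : Type*} (f : ℕ → List α) (d : α) (m i j : ℕ) (hi : i < m)
    (hj : j < (f i).length) :
    ((List.range m).flatMap f).getD (∑ i' ∈ Finset.range i, (f i').length + j) d =
      (f i).getD j d := by
  have hlen : ∀ m, ((List.range m).flatMap f).length = ∑ i' ∈ Finset.range m, (f i').length := by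
    intro m
    induction m with
    | zero => simp
    | succ m ih => simp [List.range_succ, Finset.sum_range_succ, ← ih]
  induction m with
  | zero => omega
  | succ m ih =>
    rw [List.range_succ, List.flatMap_append]
    rcases Nat.lt_succ_iff_lt_or_eq.mp hi with h | rfl
    · rw [List.getD_append, ih h]
      rw [hlen]
      calc _ < ∑ i' ∈ Finset.range (i + 1), (f i').length := by
            rw [Finset.sum_range_succ]; omega
        _ ≤ _ := Finset.sum_le_sum_of_subset (Finset.range_mono h)
    · rw [List.getD_append_right _ _ _ _ (by rw [hlen]; omega), hlen]
      simp

/-! ### Position of the subcolumns inside the next column -/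

namespace RankOneData

variable (R : RankOneData)

/-- The height in the column `n + 1` at which the `i`-th subcolumn of the column `n` starts. -/
noncomputable def offset (n i : ℕ) : ℕ := ∑ i' ∈ Finset.range i, (R.height n + R.s n i')

theorem offset_succ (n i : ℕ) : R.offset n (i + 1) = R.offset n i + R.height n + R.s n i := by
  rw [offset, Finset.sum_range_succ, ← add_assoc]; rfl

theorem height_succ (n : ℕ) : R.height (n + 1) = R.offset n (R.r n + 1) := by
  rw [height, levels, List.length_flatMap, offset]
  generalize R.r n + 1 = l
  induction l with
  | zero => simp
  | succ l ih =>
    rw [List.range_succ, List.map_append, List.sum_append, ih, Finset.sum_range_succ]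
    simp [height]

theorem offset_mono (n : ℕ) : Monotone (R.offset n) :=
  monotone_nat_of_le_succ fun i => by rw [offset_succ]; omega

theorem offset_add_lt {n i : ℕ} (hi : i ≤ R.r n) : R.offset n i + R.height n ≤ R.height (n + 1) := by
  have := R.offset_mono n (Nat.succ_le_succ hi)
  rw [offset_succ, ← height_succ] at this
  omega

theorem height_pos (n : ℕ) : 0 < R.height n := by
  induction n with
  | zero => simp [height, levels]
  | succ n ih => exact ih.trans_le ((Nat.le_add_left _ _).trans (R.offset_add_lt (Nat.zero_le _)))

theorem base_offset {n i j : ℕ} (hi : i ≤ R.r n) (hj : j < R.height n) :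
    R.base (n + 1) (R.offset n i + j) = R.base n j + i * R.width (n + 1) := by
  have h := List.flatMap_range_getD (fun i : ℕ =>
      (R.levels n).map (fun a => a + i * R.width (n + 1)) ++
        (List.range (R.s n i)).map fun m : ℕ =>
          (R.levels n).length * R.width n
            + (((∑ i' ∈ Finset.range i, R.s n i' : ℕ) : ℝ) + m) * R.width (n + 1)) 0 (R.r n + 1) i j
    (by omega) (by simp; exact Nat.lt_add_right _ hj)
  rw [← levels] at h
  simp only [List.length_append, List.length_map, List.length_range] at h
  rw [base, offset]
  refine h.trans ?_
  unfold height at hj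
  rw [List.getD_append _ _ _ _ (by simpa using hj)]
  simp [base, hj]

theorem length_word (n : ℕ) : (R.word n).length = R.height n := by
  induction n with
  | zero => simp [height, levels, word]
  | succ n ih =>
    rw [height_succ, word, List.length_flatMap, offset]
    generalize R.r n + 1 = l
    induction l with
    | zero => simp
    | succ l ih' =>
      rw [List.range_succ, List.map_append, List.sum_append, ih', Finset.sum_range_succ]
      simp [ih]

/-- Words and levels share the same offsets, so the symbol at a point's height does not depend on
the column in which it is read. -/
theorem word_offset {n i j : ℕ} (hi : i ≤ R.r n) (hj : j < R.height n) :
    (R.word (n + 1)).getD (R.offset n i + j) 0 = (R.word n).getD j 0 := by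
  have h := List.flatMap_range_getD (fun i : ℕ => R.word n ++ List.replicate (R.s n i) 1) 0
    (R.r n + 1) i j (by omega) (by simp [length_word]; omega)
  rw [← word] at h
  simp only [List.length_append, length_word, List.length_replicate] at h
  refine h.trans ?_
  rw [List.getD_append _ _ _ _ (by simpa [length_word] using hj)]

/-- Left endpoints are distinct multiples of the width, so two levels that overlap have the same
endpoint. -/
theorem eq_of_mem_level {n j j' : ℕ} {x : ℝ} (hj : j < R.height n) (hj' : j' < R.height n)
    (hx : x ∈ R.level n j) (hx' : x ∈ R.level n j') : j = j' := by
  obtain ⟨g, nd⟩ := R.levels_grid n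
  have hw := R.width_pos n
  unfold height at hj hj'
  have e1 : R.base n j = (R.levels n)[j] := by simp [base, hj]
  have e2 : R.base n j' = (R.levels n)[j'] := by simp [base, hj']
  obtain ⟨k, -, hk⟩ := g _ (List.getElem_mem hj)
  obtain ⟨k', -, hk'⟩ := g _ (List.getElem_mem hj')
  rw [level, e1, hk] at hx
  rw [level, e2, hk'] at hx'
  obtain ⟨h1, h2⟩ := hx
  obtain ⟨h1', h2'⟩ := hx'
  have a1 : (k : ℝ) < k' + 1 := by by_contra! hc; nlinarith
  have a2 : (k' : ℝ) < k + 1 := by by_contra! hc; nlinarith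
  have a1' : k < k' + 1 := by exact_mod_cast a1
  have a2' : k' < k + 1 := by exact_mod_cast a2
  have : k = k' := by omega
  subst this
  exact (nd.getElem_inj_iff).mp (hk.trans hk'.symm)

theorem mem_level_offset {n i j : ℕ} (hi : i ≤ R.r n) (hj : j < R.height n) (x : ℝ) :
    x ∈ R.level (n + 1) (R.offset n i + j) ↔
      R.base n j + i * R.width (n + 1) ≤ x ∧ x < R.base n j + (i + 1) * R.width (n + 1) := by
  rw [level, R.base_offset hi hj, Set.mem_Ico, add_mul (i : ℝ), one_mul, add_assoc]

theorem level_offset_subset {n i j : ℕ} (hi : i ≤ R.r n) (hj : j < R.height n) :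
    R.level (n + 1) (R.offset n i + j) ⊆ R.level n j := by
  intro x hx
  rw [R.mem_level_offset hi hj] at hx
  have hw := R.width_pos (n + 1)
  have hi' : (i : ℝ) ≤ R.r n := by exact_mod_cast hi
  refine ⟨by nlinarith [hx.1, (Nat.cast_nonneg i : (0 : ℝ) ≤ i)], ?_⟩
  rw [R.width_eq n]
  nlinarith [hx.2]

theorem exists_mem_level_offset {n j : ℕ} (hj : j < R.height n) {x : ℝ} (hx : x ∈ R.level n j) :
    ∃ i ≤ R.r n, x ∈ R.level (n + 1) (R.offset n i + j) := by
  have hw := R.width_pos (n + 1)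
  have hwn := R.width_eq n
  obtain ⟨h1, h2⟩ := hx
  have hnn : 0 ≤ (x - R.base n j) / R.width (n + 1) := div_nonneg (by linarith) hw.le
  have f1 : (⌊(x - R.base n j) / R.width (n + 1)⌋₊ : ℝ) * R.width (n + 1) ≤ x - R.base n j := by
    rw [← le_div_iff₀ hw]; exact Nat.floor_le hnn
  have f2 : x - R.base n j < (⌊(x - R.base n j) / R.width (n + 1)⌋₊ + 1) * R.width (n + 1) := by
    rw [← div_lt_iff₀ hw]; exact Nat.lt_floor_add_one _
  generalize ⌊(x - R.base n j) / R.width (n + 1)⌋₊ = i at f1 f2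
  have hir : i < R.r n + 1 := by
    have : (i : ℝ) < R.r n + 1 := by
      by_contra! hc
      nlinarith
    exact_mod_cast this
  exact ⟨i, by omega, (R.mem_level_offset (by omega) hj x).mpr ⟨by linarith, by linarith⟩⟩

theorem mem_column {n : ℕ} {x : ℝ} : x ∈ R.column n ↔ ∃ j < R.height n, x ∈ R.level n j := by
  simp [column]

theorem column_mono : Monotone R.column := by
  refine monotone_nat_of_le_succ fun n x hx => ?_
  obtain ⟨j, hj, hx⟩ := R.mem_column.mp hx
  obtain ⟨i, hi, hx⟩ := R.exists_mem_level_offset hj hx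
  have := R.offset_add_lt hi
  exact R.mem_column.mpr ⟨_, by omega, hx⟩

theorem level_subset_space {n j : ℕ} (hj : j < R.height n) : R.level n j ⊆ R.space :=
  fun _ hx => Set.mem_iUnion.mpr ⟨n, R.mem_column.mpr ⟨j, hj, hx⟩⟩

theorem column_subset_space (n : ℕ) : R.column n ⊆ R.space := Set.subset_iUnion R.column n

/-! ### Measures of levels and columns -/

theorem measurableSet_level (n j : ℕ) : MeasurableSet (R.level n j) := measurableSet_Ico

theorem measurableSet_column (n : ℕ) : MeasurableSet (R.column n) :=
  Finset.measurableSet_biUnion _ fun _ _ => R.measurableSet_level _ _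

theorem measurableSet_space : MeasurableSet R.space := MeasurableSet.iUnion R.measurableSet_column

theorem volume_level (n j : ℕ) : volume (R.level n j) = ENNReal.ofReal (R.width n) := by
  simp [level]

theorem disjoint_level {n j j' : ℕ} (hj : j < R.height n) (hj' : j' < R.height n) (h : j ≠ j') :
    Disjoint (R.level n j) (R.level n j') :=
  Set.disjoint_left.mpr fun _ hx hx' => h (R.eq_of_mem_level hj hj' hx hx')

/-- The measure of a union of levels of a column. -/
theorem volume_biUnion_level {n : ℕ} {P : Finset ℕ} (hP : ∀ j ∈ P, j < R.height n) :
    volume (⋃ j ∈ P, R.level n j) = ENNReal.ofReal (P.card * R.width n) := by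
  rw [measure_biUnion_finset (fun j hj j' hj' h => R.disjoint_level (hP j hj) (hP j' hj') h)
    fun _ _ => R.measurableSet_level _ _]
  simp only [volume_level]
  rw [Finset.sum_const, nsmul_eq_mul, ENNReal.ofReal_mul (by positivity)]
  simp

theorem volume_column (n : ℕ) : volume (R.column n) = ENNReal.ofReal (R.height n * R.width n) := by
  rw [column, volume_biUnion_level _ (by simp), Finset.card_range]

theorem width_le (n : ℕ) : R.width n ≤ (1 / 2) ^ n := by
  induction n with
  | zero => simp [width]
  | succ n ih =>
    have h1 : (1 : ℝ) ≤ R.r n := by exact_mod_cast R.one_le_r n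
    have hw := R.width_eq n
    have hp := R.width_pos (n + 1)
    rw [pow_succ]
    nlinarith

theorem tendsto_width : Tendsto R.width atTop (𝓝 0) :=
  squeeze_zero (fun n => (R.width_pos n).le) R.width_le
    (tendsto_pow_atTop_nhds_zero_of_lt_one (by norm_num) (by norm_num))

theorem tendsto_volume_column : Tendsto (fun n => volume (R.column n)) atTop (𝓝 (volume R.space)) :=
  tendsto_measure_iUnion_atTop R.column_mono

theorem tendsto_height_mul_width (hY : volume R.space ≠ ∞) :
    Tendsto (fun n => R.height n * R.width n) atTop (𝓝 (volume.real R.space)) := by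
  have h := (ENNReal.tendsto_toReal hY).comp R.tendsto_volume_column
  refine h.congr fun n => ?_
  simp only [Function.comp, volume_column]
  exact ENNReal.toReal_ofReal (mul_nonneg (Nat.cast_nonneg _) (R.width_pos n).le)

/-- Going one column up, levels and words are reproduced in each subcolumn. -/
theorem mem_level_mono {n m j : ℕ} (hnm : n ≤ m) (hj : j < R.height n) {x : ℝ}
    (hx : x ∈ R.level n j) :
    ∃ k, k + R.height n ≤ R.height m ∧ x ∈ R.level m (k + j) ∧
      ∀ l < R.height n, (R.word m).getD (k + l) 0 = (R.word n).getD l 0 := by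
  induction m, hnm using Nat.le_induction with
  | base => exact ⟨0, by omega, by simpa using hx, by simp⟩
  | succ m _ ih =>
    obtain ⟨k, h1, h2, h3⟩ := ih
    obtain ⟨i, hi, h⟩ := R.exists_mem_level_offset (by omega) h2
    have := R.offset_add_lt hi
    refine ⟨R.offset m i + k, by omega, by rwa [add_assoc], fun l hl => ?_⟩
    rw [add_assoc, R.word_offset hi (by omega), h3 l hl]

/-! ### The transformation on levels and subcolumns -/

theorem add_mem_level {n j : ℕ} {x : ℝ} (hx : x ∈ R.level n j) (j' : ℕ) :
    x + (R.base n j' - R.base n j) ∈ R.level n j' := by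
  obtain ⟨h1, h2⟩ := hx
  constructor <;> linarith

theorem map_mem_level {n j : ℕ} (hj : j + 1 < R.height n) {x : ℝ} (hx : x ∈ R.level n j) :
    R.map x ∈ R.level n (j + 1) := by
  rw [R.map_eq hj hx]
  exact R.add_mem_level hx _

theorem iterate_map_eq {n j k : ℕ} (hj : j + k < R.height n) {x : ℝ} (hx : x ∈ R.level n j) :
    R.map^[k] x = x + (R.base n (j + k) - R.base n j) := by
  induction k with
  | zero => simp
  | succ k ih =>
    rw [Function.iterate_succ_apply', ih (by omega), R.map_eq (n := n) (j := j + k) (by omega)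
      (R.add_mem_level hx _), ← add_assoc]
    ring

/-- Going up by the height of a column and the spacers above a subcolumn leads from this subcolumn
to the next one. -/
theorem iterate_map_subcolumn {n i j : ℕ} (hi : i < R.r n) (hj : j < R.height n) {x : ℝ}
    (hx : x ∈ R.level (n + 1) (R.offset n i + j)) :
    R.map^[R.height n + R.s n i] x = x + R.width (n + 1) := by
  have e : R.offset n i + j + (R.height n + R.s n i) = R.offset n (i + 1) + j := by
    rw [offset_succ]; ring
  have := R.offset_add_lt (n := n) (i := i + 1) hi
  rw [R.iterate_map_eq (by omega) hx, e, R.base_offset hi hj, R.base_offset hi.le hj]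
  push_cast
  ring

/-- Subcolumns are adjacent vertical strips: as `i < R.r n`, strip `i + 1` exists, and translation
by its width stays inside the level being cut. -/
theorem add_width_mem_level {n i j : ℕ} (hi : i < R.r n) (hj : j < R.height n) {x : ℝ}
    (hx : x ∈ R.level (n + 1) (R.offset n i + j)) : x + R.width (n + 1) ∈ R.level n j := by
  refine R.level_offset_subset (i := i + 1) hi hj ?_
  rw [R.mem_level_offset hi.le hj] at hx
  rw [R.mem_level_offset hi hj]
  push_cast
  constructor <;> linarith [hx.1, hx.2]

/-! ### Invariance of the measure -/

/-- By `map_eq` the map is a translation on each of the countably many non-top levels; elsewhere it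
is the identity. -/
theorem measurable_map : Measurable R.map := by
  intro S hS
  set I : Set (ℕ × ℕ) := {p | p.2 + 1 < R.height p.1}
  have hG : MeasurableSet (⋃ p ∈ I, R.level p.1 p.2) :=
    MeasurableSet.biUnion (Set.to_countable I) fun p _ => R.measurableSet_level _ _
  have key : R.map ⁻¹' S = (⋃ p ∈ I, R.level p.1 p.2 ∩
      (fun x => x + (R.base p.1 (p.2 + 1) - R.base p.1 p.2)) ⁻¹' S) ∪
      ((⋃ p ∈ I, R.level p.1 p.2)ᶜ ∩ S) := by
    ext x
    simp only [Set.mem_preimage, Set.mem_union, Set.mem_inter_iff, Set.mem_iUnion, Set.mem_compl_iff,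
      exists_prop, Prod.exists]
    by_cases hx : ∃ a b, (a, b) ∈ I ∧ x ∈ R.level a b
    · obtain ⟨a, b, hab, h⟩ := hx
      constructor
      · intro hS
        rw [R.map_eq hab h] at hS
        exact Or.inl ⟨a, b, hab, h, hS⟩
      · rintro (⟨a', b', hab', h', hS⟩ | ⟨h', -⟩)
        · rwa [R.map_eq hab' h']
        · exact absurd ⟨a, b, hab, h⟩ h'
    · have : R.map x = x := by
        rw [map, dif_neg]
        rintro ⟨p, hp⟩
        exact hx ⟨p.1, p.2, hp⟩
      rw [this]
      constructor
      · exact fun h => Or.inr ⟨hx, h⟩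
      · rintro (⟨a', b', hab', h', hS⟩ | ⟨-, h⟩)
        · exact absurd ⟨a', b', hab', h'⟩ hx
        · exact h
  rw [key]
  refine .union (.biUnion (Set.to_countable I) fun p _ => (R.measurableSet_level _ _).inter ?_)
    (hG.compl.inter hS)
  exact (measurable_id.add_const _) hS

theorem volume_preimage_map_inter_level {n j : ℕ} (hj : j + 1 < R.height n) (S : Set ℝ) :
    volume (R.map ⁻¹' S ∩ R.level n j) = volume (S ∩ R.level n (j + 1)) := by
  rw [← measure_preimage_add_right volume (R.base n (j + 1) - R.base n j)
    (S ∩ R.level n (j + 1))]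
  congr 1
  ext x
  simp only [Set.mem_inter_iff, Set.mem_preimage]
  constructor
  · rintro ⟨h1, h2⟩
    rw [R.map_eq hj h2] at h1
    exact ⟨h1, R.add_mem_level h2 _⟩
  · rintro ⟨h1, h2⟩
    have h3 : x ∈ R.level n j := by
      have := R.add_mem_level h2 j
      rwa [add_assoc, sub_add_sub_cancel, sub_self, add_zero] at this
    exact ⟨by rwa [R.map_eq hj h3], h3⟩

theorem volume_inter_column (n : ℕ) {S : Set ℝ} (hS : MeasurableSet S) :
    volume (S ∩ R.column n) = ∑ j ∈ Finset.range (R.height n), volume (S ∩ R.level n j) := by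
  rw [column, Set.inter_iUnion₂, measure_biUnion_finset]
  · intro j hj j' hj' h
    exact (R.disjoint_level (by simpa using hj) (by simpa using hj') h).mono
      Set.inter_subset_right Set.inter_subset_right
  · exact fun _ _ => hS.inter (R.measurableSet_level _ _)

/-- The non-top levels are translated to distinct levels; the top level costs at most its own width,
which vanishes in the limit. -/
theorem volume_preimage_map_le {S : Set ℝ} (hS : MeasurableSet S) (n : ℕ) :
    volume (R.map ⁻¹' S ∩ R.column n) ≤ volume (S ∩ R.space) + ENNReal.ofReal (R.width n) := by
  rw [R.volume_inter_column n (R.measurable_map hS)]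
  obtain ⟨m, hm⟩ := Nat.exists_eq_succ_of_ne_zero (R.height_pos n).ne'
  rw [hm, Finset.sum_range_succ]
  refine add_le_add ?_ ?_
  · calc _ = ∑ j ∈ Finset.range m, volume (S ∩ R.level n (j + 1)) := by
          refine Finset.sum_congr rfl fun j hj => R.volume_preimage_map_inter_level ?_ S
          rw [Finset.mem_range] at hj
          omega
      _ ≤ volume (S ∩ R.column n) := by
          rw [R.volume_inter_column n hS, hm, Finset.sum_range_succ']
          exact le_self_add
      _ ≤ _ := measure_mono (Set.inter_subset_inter_right _ (R.column_subset_space n))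
  · rw [← R.volume_level n m]
    exact measure_mono Set.inter_subset_right

theorem measurePreserving_map_restrict (hY : volume R.space ≠ ∞) :
    MeasurePreserving R.map (volume.restrict R.space) (volume.restrict R.space) := by
  have : Fact (volume R.space < ∞) := ⟨hY.lt_top⟩
  -- For finite measures of equal total mass, one inequality suffices; this avoids inverting the
  -- map.
  refine ⟨R.measurable_map, Measure.eq_of_le_of_measure_univ_eq (Measure.le_iff.mpr fun S hS => ?_) ?_⟩
  · rw [Measure.map_apply R.measurable_map hS, Measure.restrict_apply (R.measurable_map hS),
      Measure.restrict_apply hS]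
    have h1 : Tendsto (fun n => volume (R.map ⁻¹' S ∩ R.column n)) atTop
        (𝓝 (volume (R.map ⁻¹' S ∩ R.space))) := by
      rw [space, Set.inter_iUnion]
      exact tendsto_measure_iUnion_atTop fun _ _ h =>
        Set.inter_subset_inter_right _ (R.column_mono h)
    have h2 : Tendsto (fun n => volume (S ∩ R.space) + ENNReal.ofReal (R.width n)) atTop
        (𝓝 (volume (S ∩ R.space) + ENNReal.ofReal 0)) :=
      ((ENNReal.tendsto_ofReal R.tendsto_width)).const_add _
    simpa using le_of_tendsto_of_tendsto' h1 h2 (R.volume_preimage_map_le hS)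
  · rw [Measure.map_apply R.measurable_map .univ, Set.preimage_univ]

theorem volume_space_ne_zero : volume R.space ≠ 0 := by
  have h := measure_mono (μ := volume) (R.level_subset_space (R.height_pos 0))
  rw [volume_level] at h
  have := ENNReal.ofReal_pos.mpr (R.width_pos 0)
  exact (this.trans_le h).ne'

theorem measure_eq : R.measure = (volume R.space)⁻¹ • volume.restrict R.space := rfl

theorem isProbabilityMeasure (hY : volume R.space ≠ ∞) : IsProbabilityMeasure R.measure :=
  cond_isProbabilityMeasure_of_finite R.volume_space_ne_zero hY

theorem measurePreserving_map (hY : volume R.space ≠ ∞) :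
    MeasurePreserving R.map R.measure R.measure :=
  (R.measurePreserving_map_restrict hY).smul_measure _

/-! ### Approximation by products of levels -/

/-- A product of two levels of the same column. -/
def box (n : ℕ) (p : ℕ × ℕ) : Set (ℝ × ℝ) := R.level n p.1 ×ˢ R.level n p.2

/-- The pairs of levels of a column whose product is contained in `U`. -/
noncomputable def boxesIn (n : ℕ) (U : Set (ℝ × ℝ)) : Finset (ℕ × ℕ) :=
  open Classical in
  (Finset.range (R.height n) ×ˢ Finset.range (R.height n)).filter fun p => R.box n p ⊆ U

/-- A union of products of levels. -/
def boxes (n : ℕ) (P : Finset (ℕ × ℕ)) : Set (ℝ × ℝ) := ⋃ p ∈ P, R.box n p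

theorem mem_boxesIn {n : ℕ} {U : Set (ℝ × ℝ)} {p : ℕ × ℕ} :
    p ∈ R.boxesIn n U ↔ p.1 < R.height n ∧ p.2 < R.height n ∧ R.box n p ⊆ U := by
  simp [boxesIn, and_assoc]

theorem measurableSet_box (n : ℕ) (p : ℕ × ℕ) : MeasurableSet (R.box n p) :=
  (R.measurableSet_level _ _).prod (R.measurableSet_level _ _)

theorem measurableSet_boxes (n : ℕ) (P : Finset (ℕ × ℕ)) : MeasurableSet (R.boxes n P) :=
  Finset.measurableSet_biUnion _ fun _ _ => R.measurableSet_box _ _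

theorem boxesIn_mono (U : Set (ℝ × ℝ)) : Monotone fun n => R.boxes n (R.boxesIn n U) := by
  refine monotone_nat_of_le_succ fun n x hx => ?_
  simp only [boxes, Set.mem_iUnion, exists_prop, mem_boxesIn] at hx ⊢
  obtain ⟨⟨a, b⟩, ⟨ha, hb, hU⟩, hx1, hx2⟩ := hx
  obtain ⟨i, hi, hx1⟩ := R.exists_mem_level_offset ha hx1
  obtain ⟨j, hj, hx2⟩ := R.exists_mem_level_offset hb hx2
  have h1 := R.offset_add_lt hi
  have h2 := R.offset_add_lt hj
  refine ⟨(R.offset n i + a, R.offset n j + b), ⟨?_, ?_, ?_⟩, hx1, hx2⟩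
  · dsimp only at *; omega
  · dsimp only at *; omega
  · exact (Set.prod_mono (R.level_offset_subset hi ha) (R.level_offset_subset hj hb)).trans hU

/-- The widths tend to 0, so the box around a point of the open set eventually lies inside it. -/
theorem iUnion_boxes_boxesIn {U : Set (ℝ × ℝ)} (hU : IsOpen U) :
    ⋃ n, R.boxes n (R.boxesIn n U) = U ∩ R.space ×ˢ R.space := by
  ext x
  simp only [Set.mem_iUnion, boxes, exists_prop, mem_boxesIn]
  constructor
  · rintro ⟨n, p, ⟨h1, h2, h⟩, hx⟩
    exact ⟨h hx, R.level_subset_space h1 hx.1, R.level_subset_space h2 hx.2⟩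
  · rintro ⟨hx, h1, h2⟩
    obtain ⟨ε, hε, hball⟩ := Metric.isOpen_iff.mp hU x hx
    obtain ⟨n₁, h1⟩ := Set.mem_iUnion.mp h1
    obtain ⟨n₂, h2⟩ := Set.mem_iUnion.mp h2
    obtain ⟨n, hn, hn1, hn2⟩ := ((R.tendsto_width.eventually_lt_const hε).and
      ((eventually_ge_atTop n₁).and (eventually_ge_atTop n₂))).exists
    obtain ⟨a, ha, h1⟩ := R.mem_column.mp (R.column_mono hn1 h1)
    obtain ⟨b, hb, h2⟩ := R.mem_column.mp (R.column_mono hn2 h2)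
    refine ⟨n, (a, b), ⟨ha, hb, fun y hy => hball ?_⟩, h1, h2⟩
    rw [Metric.mem_ball, Prod.dist_eq, max_lt_iff]
    have aux : ∀ (j : ℕ) (u v : ℝ), u ∈ R.level n j → v ∈ R.level n j → dist u v < ε := by
      rintro j u v ⟨hu, hu'⟩ ⟨hv, hv'⟩
      rw [Real.dist_eq, abs_lt]
      constructor <;> linarith
    exact ⟨aux _ _ _ hy.1 h1, aux _ _ _ hy.2 h2⟩

/-- Lebesgue measure on the square of the space. -/
noncomputable def sq : Measure (ℝ × ℝ) := volume.restrict (R.space ×ˢ R.space)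

theorem sq_eq : R.sq = (volume.restrict R.space).prod (volume.restrict R.space) := by
  rw [sq, Measure.prod_restrict]; rfl

theorem isFiniteMeasure_sq (hY : volume R.space ≠ ∞) : IsFiniteMeasure R.sq := by
  have : Fact (volume R.space < ∞) := ⟨hY.lt_top⟩
  rw [sq_eq]
  infer_instance

theorem sq_of_subset {S : Set (ℝ × ℝ)} (h : S ⊆ R.space ×ˢ R.space) : R.sq S = volume S :=
  Measure.restrict_eq_self _ h

theorem box_subset {n : ℕ} {p : ℕ × ℕ} (h1 : p.1 < R.height n) (h2 : p.2 < R.height n) :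
    R.box n p ⊆ R.space ×ˢ R.space :=
  Set.prod_mono (R.level_subset_space h1) (R.level_subset_space h2)

theorem disjoint_box {n : ℕ} {p q : ℕ × ℕ} (hp1 : p.1 < R.height n) (hp2 : p.2 < R.height n)
    (hq1 : q.1 < R.height n) (hq2 : q.2 < R.height n) (h : p ≠ q) :
    Disjoint (R.box n p) (R.box n q) :=
  Set.disjoint_left.mpr fun _ hx hx' => h (Prod.ext (R.eq_of_mem_level hp1 hq1 hx.1 hx'.1)
    (R.eq_of_mem_level hp2 hq2 hx.2 hx'.2))

theorem tendsto_measure_boxesIn (μ : Measure (ℝ × ℝ)) {U : Set (ℝ × ℝ)} (hU : IsOpen U) :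
    Tendsto (fun n => μ (R.boxes n (R.boxesIn n U))) atTop (𝓝 (μ (U ∩ R.space ×ˢ R.space))) := by
  rw [← R.iUnion_boxes_boxesIn hU]
  exact tendsto_measure_iUnion_atTop (R.boxesIn_mono U)

/-- Measurable sets are approximated by unions of products of levels. -/
theorem eventually_exists_boxes (hY : volume R.space ≠ ∞) {A : Set (ℝ × ℝ)} (hA : MeasurableSet A)
    {ε : ℝ} (hε : 0 < ε) :
    ∀ᶠ n in atTop, ∃ P : Finset (ℕ × ℕ), (∀ p ∈ P, p.1 < R.height n ∧ p.2 < R.height n) ∧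
      R.sq.real (symmDiff A (R.boxes n P)) < ε := by
  have := R.isFiniteMeasure_sq hY
  -- One half of `ε` pays for the open set `U` around `A`, the other for exhausting `U` by boxes.
  obtain ⟨U, hAU, hU, -, hlt⟩ := hA.exists_isOpen_sdiff_lt (μ := R.sq) (measure_ne_top _ _)
    (ENNReal.ofReal_pos.mpr (half_pos hε)).ne'
  have hlt' : R.sq.real (U \ A) < ε / 2 :=
    (ENNReal.lt_ofReal_iff_toReal_lt (measure_ne_top _ _)).mp hlt
  have h := (ENNReal.tendsto_toReal (measure_ne_top _ _)).comp (R.tendsto_measure_boxesIn R.sq hU)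
  have hUs : R.sq (U ∩ R.space ×ˢ R.space) = R.sq U := by
    rw [sq, Measure.restrict_apply hU.measurableSet, Measure.restrict_apply
      (hU.measurableSet.inter (R.measurableSet_space.prod R.measurableSet_space)), Set.inter_assoc,
      Set.inter_self]
  rw [hUs] at h
  filter_upwards [h.eventually_const_lt (u := R.sq.real U - ε / 2) (by
    rw [← measureReal_def]; linarith)] with n hn
  refine ⟨R.boxesIn n U, fun p hp => ?_, ?_⟩
  · have := R.mem_boxesIn.mp hp
    exact ⟨this.1, this.2.1⟩
  · have hBU : R.boxes n (R.boxesIn n U) ⊆ U :=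
      Set.iUnion₂_subset fun p hp => (R.mem_boxesIn.mp hp).2.2
    have hd := measureReal_sdiff (μ := R.sq) hBU (R.measurableSet_boxes _ _)
    rw [Function.comp, ← measureReal_def] at hn
    calc _ ≤ R.sq.real ((U \ A) ∪ (U \ R.boxes n (R.boxesIn n U))) := by
          refine measureReal_mono ?_
          rintro x (⟨h1, h2⟩ | ⟨h1, h2⟩)
          · exact Or.inr ⟨hAU h1, h2⟩
          · exact Or.inl ⟨hBU h1, h2⟩
      _ ≤ _ := measureReal_union_le _ _
      _ < ε := by linarith

/-! ### Products of unions of subcolumns -/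

/-- The union of the subcolumns of the column `n` with the given numbers. -/
noncomputable def subcolumns (n : ℕ) (Z : Finset ℕ) : Set ℝ :=
  ⋃ i ∈ Z, ⋃ a ∈ Finset.range (R.height n), R.level (n + 1) (R.offset n i + a)

theorem mem_subcolumns {n : ℕ} {Z : Finset ℕ} {x : ℝ} : x ∈ R.subcolumns n Z ↔
    ∃ i ∈ Z, ∃ a < R.height n, x ∈ R.level (n + 1) (R.offset n i + a) := by
  simp [subcolumns]

theorem measurableSet_subcolumns (n : ℕ) (Z : Finset ℕ) : MeasurableSet (R.subcolumns n Z) :=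
  Finset.measurableSet_biUnion _ fun _ _ =>
    Finset.measurableSet_biUnion _ fun _ _ => R.measurableSet_level _ _

theorem offset_injective (n : ℕ) : Function.Injective (R.offset n) :=
  (strictMono_nat_of_lt_succ fun i => by
    have := R.height_pos n
    rw [offset_succ]
    omega).injective

theorem le_volume_subcolumns_inter_level {n : ℕ} {Z : Finset ℕ} (hZ : ∀ i ∈ Z, i ≤ R.r n) {a : ℕ}
    (ha : a < R.height n) :
    ENNReal.ofReal (Z.card * R.width (n + 1)) ≤ volume (R.subcolumns n Z ∩ R.level n a) := by
  have hc : (Z.image fun i => R.offset n i + a).card = Z.card :=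
    Finset.card_image_of_injective _ fun i j h => R.offset_injective n (by simpa using h)
  rw [← hc, ← R.volume_biUnion_level]
  · refine measure_mono fun x hx => ?_
    simp only [Set.mem_iUnion, Finset.mem_image, exists_prop] at hx
    obtain ⟨_, ⟨i, hi, rfl⟩, hx⟩ := hx
    exact ⟨R.mem_subcolumns.mpr ⟨i, hi, a, ha, hx⟩, R.level_offset_subset (hZ i hi) ha hx⟩
  · intro j hj
    obtain ⟨i, hi, rfl⟩ := Finset.mem_image.mp hj
    have := R.offset_add_lt (hZ i hi)
    omega

theorem sq_box {n : ℕ} {p : ℕ × ℕ} (h1 : p.1 < R.height n) (h2 : p.2 < R.height n) :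
    R.sq.real (R.box n p) = R.width n * R.width n := by
  have hw := (R.width_pos n).le
  rw [measureReal_def, R.sq_of_subset (R.box_subset h1 h2), box, Measure.volume_eq_prod,
    Measure.prod_prod, volume_level, volume_level, ENNReal.toReal_mul, ENNReal.toReal_ofReal hw]

theorem sq_inter_boxes (hY : volume R.space ≠ ∞) {n : ℕ} {P : Finset (ℕ × ℕ)}
    (hP : ∀ p ∈ P, p.1 < R.height n ∧ p.2 < R.height n) {S : Set (ℝ × ℝ)} (hS : MeasurableSet S) :
    R.sq.real (S ∩ R.boxes n P) = ∑ p ∈ P, R.sq.real (S ∩ R.box n p) := by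
  have := R.isFiniteMeasure_sq hY
  rw [boxes, Set.inter_iUnion₂, measureReal_biUnion_finset]
  · intro p hp q hq h
    exact (R.disjoint_box (hP p hp).1 (hP p hp).2 (hP q hq).1 (hP q hq).2 h).mono
      Set.inter_subset_right Set.inter_subset_right
  · exact fun _ _ => hS.inter (R.measurableSet_box _ _)

theorem sq_boxes (hY : volume R.space ≠ ∞) {n : ℕ} {P : Finset (ℕ × ℕ)}
    (hP : ∀ p ∈ P, p.1 < R.height n ∧ p.2 < R.height n) :
    R.sq.real (R.boxes n P) = P.card * (R.width n * R.width n) := by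
  rw [← Set.univ_inter (R.boxes n P), R.sq_inter_boxes hY hP .univ,
    Finset.sum_congr rfl fun p hp => by rw [Set.univ_inter, R.sq_box (hP p hp).1 (hP p hp).2]]
  simp

/-- Each factor fills at least the proportion `κ` of every level, so the product fills at least `κ ^
2` of every box. This fails for general sets in place of boxes, hence the approximations later. -/
theorem le_sq_inter_boxes (hY : volume R.space ≠ ∞) {n : ℕ} {P : Finset (ℕ × ℕ)}
    (hP : ∀ p ∈ P, p.1 < R.height n ∧ p.2 < R.height n) {Z O : Finset ℕ}
    (hZ : ∀ i ∈ Z, i ≤ R.r n) (hO : ∀ i ∈ O, i ≤ R.r n) {κ : ℝ} (hκ : 0 < κ)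
    (hZκ : κ * (R.r n + 1) ≤ Z.card) (hOκ : κ * (R.r n + 1) ≤ O.card) :
    κ ^ 2 * R.sq.real (R.boxes n P) ≤
      R.sq.real ((R.subcolumns n Z ×ˢ R.subcolumns n O) ∩ R.boxes n P) := by
  have := R.isFiniteMeasure_sq hY
  rw [R.sq_boxes hY hP, R.sq_inter_boxes hY hP
    ((R.measurableSet_subcolumns _ _).prod (R.measurableSet_subcolumns _ _)), mul_left_comm,
    ← nsmul_eq_mul]
  refine Finset.card_nsmul_le_sum _ _ _ fun p hp => ?_
  have hw := R.width_pos (n + 1)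
  have key : ∀ {Q : Finset ℕ} {a : ℕ}, (∀ i ∈ Q, i ≤ R.r n) → a < R.height n →
      κ * (R.r n + 1) ≤ Q.card →
      ENNReal.ofReal (κ * R.width n) ≤ volume (R.subcolumns n Q ∩ R.level n a) := by
    intro Q a hQ ha hc
    refine le_trans (ENNReal.ofReal_le_ofReal ?_) (R.le_volume_subcolumns_inter_level hQ ha)
    rw [R.width_eq n, ← mul_assoc]
    exact mul_le_mul_of_nonneg_right hc hw.le
  rw [measureReal_def, R.sq_of_subset (Set.inter_subset_right.trans
    (R.box_subset (hP p hp).1 (hP p hp).2)), ← ENNReal.ofReal_le_iff_le_toReal, box,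
    Set.prod_inter_prod, Measure.volume_eq_prod, Measure.prod_prod]
  · have hwn := R.width_pos n
    calc _ = ENNReal.ofReal (κ * R.width n) * ENNReal.ofReal (κ * R.width n) := by
          rw [← ENNReal.ofReal_mul (by positivity)]; congr 1; ring
      _ ≤ _ := mul_le_mul' (key hZ (hP p hp).1 hZκ) (key hO (hP p hp).2 hOκ)
  · refine ne_top_of_le_ne_top ?_ (measure_mono Set.inter_subset_right)
    rw [← R.sq_of_subset (R.box_subset (hP p hp).1 (hP p hp).2)]
    exact measure_ne_top _ _

/-- Passing to the next subcolumn changes neither of the two levels, so the point stays in its box.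
-/
theorem mem_boxes_add_iff {n : ℕ} {P : Finset (ℕ × ℕ)}
    (hP : ∀ p ∈ P, p.1 < R.height n ∧ p.2 < R.height n) {Z O : Finset ℕ}
    (hZ : ∀ i ∈ Z, i < R.r n) (hO : ∀ i ∈ O, i < R.r n) {x : ℝ × ℝ}
    (hx : x ∈ R.subcolumns n Z ×ˢ R.subcolumns n O) :
    x + (R.width (n + 1), R.width (n + 1)) ∈ R.boxes n P ↔ x ∈ R.boxes n P := by
  obtain ⟨h1, h2⟩ := hx
  obtain ⟨i, hi, a, ha, h1⟩ := R.mem_subcolumns.mp h1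
  obtain ⟨j, hj, b, hb, h2⟩ := R.mem_subcolumns.mp h2
  have h1' := R.add_width_mem_level (hZ i hi) ha h1
  have h2' := R.add_width_mem_level (hO j hj) hb h2
  have h1 := R.level_offset_subset (hZ i hi).le ha h1
  have h2 := R.level_offset_subset (hO j hj).le hb h2
  have key : ∀ {y : ℝ × ℝ}, y.1 ∈ R.level n a → y.2 ∈ R.level n b →
      (y ∈ R.boxes n P ↔ (a, b) ∈ P) := by
    intro y hy1 hy2
    simp only [boxes, Set.mem_iUnion, exists_prop]
    constructor
    · rintro ⟨⟨c, d⟩, hp, hc, hd⟩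
      have e1 := R.eq_of_mem_level ha (hP _ hp).1 hy1 hc
      have e2 := R.eq_of_mem_level hb (hP _ hp).2 hy2 hd
      dsimp only at e1 e2
      rwa [e1, e2]
    · exact fun hp => ⟨_, hp, hy1, hy2⟩
  rw [key h1 h2, key h1' h2']

theorem subcolumns_subset_space {n : ℕ} {Z : Finset ℕ} (hZ : ∀ i ∈ Z, i ≤ R.r n) :
    R.subcolumns n Z ⊆ R.space := by
  intro x hx
  obtain ⟨i, hi, a, ha, hx⟩ := R.mem_subcolumns.mp hx
  exact R.level_subset_space ha (R.level_offset_subset (hZ i hi) ha hx)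

/-! ### Ergodicity of T × T -/

variable {R}

/-- A set invariant under `T × T` is invariant under `id × T` on the products of the subcolumns
followed by no spacer with those followed by one spacer, up to a translation. -/
theorem mem_iff_add_mem {A : Set (ℝ × ℝ)} (hA : Prod.map R.map R.map ⁻¹' A = A) {n : ℕ}
    {Z O : Finset ℕ} (hZ : ∀ i ∈ Z, i < R.r n ∧ R.s n i = 0)
    (hO : ∀ i ∈ O, i < R.r n ∧ R.s n i = 1) {x : ℝ × ℝ}
    (hx : x ∈ R.subcolumns n Z ×ˢ R.subcolumns n O) :
    x ∈ Prod.map id R.map ⁻¹' A ↔ x + (R.width (n + 1), R.width (n + 1)) ∈ A := by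
  obtain ⟨h1, h2⟩ := hx
  obtain ⟨i, hi, a, ha, h1⟩ := R.mem_subcolumns.mp h1
  obtain ⟨j, hj, b, hb, h2⟩ := R.mem_subcolumns.mp h2
  have e1 := R.iterate_map_subcolumn (hZ i hi).1 ha h1
  have e2 := R.iterate_map_subcolumn (hO j hj).1 hb h2
  rw [(hZ i hi).2, add_zero] at e1
  rw [(hO j hj).2, Function.iterate_succ_apply] at e2
  have hk : ∀ k (y : ℝ × ℝ), y ∈ A ↔ (R.map^[k] y.1, R.map^[k] y.2) ∈ A := by
    intro k
    induction k with
    | zero => simp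
    | succ k ih =>
      intro y
      rw [ih y]
      conv_lhs => rw [← hA]
      simp only [Function.iterate_succ_apply', Set.mem_preimage, Prod.map]
  -- Applying (T × T)^h to (x, T y) gives (T^h x, T^(h+1) y): the missing spacer in the first
  -- coordinate is made up by the extra T in the second.
  rw [Set.mem_preimage, hk (R.height n)]
  simp only [Prod.map, id, e1, e2]
  rfl

theorem sq_symmDiff_eq_zero (hY : volume R.space ≠ ∞) {κ : ℝ} (hκ : 0 < κ)
    (h : ∀ᶠ n in atTop,
        κ * (R.r n + 1) ≤ (((Finset.range (R.r n)).filter fun i => R.s n i = 0).card : ℝ) ∧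
        κ * (R.r n + 1) ≤ (((Finset.range (R.r n)).filter fun i => R.s n i = 1).card : ℝ))
    {A : Set (ℝ × ℝ)} (hAm : MeasurableSet A) (hA : Prod.map R.map R.map ⁻¹' A = A) :
    R.sq (symmDiff A (Prod.map id R.map ⁻¹' A)) = 0 := by
  have := R.isFiniteMeasure_sq hY
  set D := symmDiff A (Prod.map id R.map ⁻¹' A) with hD
  have hDm : MeasurableSet D := hAm.symmDiff ((measurable_id.prodMap R.measurable_map) hAm)
  rw [← measureReal_eq_zero_iff]
  -- The boxes approximating `D` cost `κ ^ 2 * ε` in `h3` and `ε` in `h2`; the boxes approximating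
  -- `A` cost `2 * ε` in `h5`.
  have key : ∀ ε > 0, κ ^ 2 * R.sq.real D ≤ (3 + κ ^ 2) * ε := by
    intro ε hε
    obtain ⟨n, ⟨hZc, hOc⟩, ⟨P, hP, hPA⟩, ⟨Q, hQ, hQD⟩⟩ := (h.and
      ((R.eventually_exists_boxes hY hAm hε).and (R.eventually_exists_boxes hY hDm hε))).exists
    set Z := (Finset.range (R.r n)).filter fun i => R.s n i = 0
    set O := (Finset.range (R.r n)).filter fun i => R.s n i = 1
    have hZ : ∀ i ∈ Z, i < R.r n ∧ R.s n i = 0 := fun i hi => by simpa [Z] using hi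
    have hO : ∀ i ∈ O, i < R.r n ∧ R.s n i = 1 := fun i hi => by simpa [O] using hi
    set E := R.subcolumns n Z ×ˢ R.subcolumns n O
    have hEs : E ⊆ R.space ×ˢ R.space :=
      Set.prod_mono (R.subcolumns_subset_space fun i hi => (hZ i hi).1.le)
        (R.subcolumns_subset_space fun i hi => (hO i hi).1.le)
    set B := R.boxes n P
    set v : ℝ × ℝ := (R.width (n + 1), R.width (n + 1))
    have h1 := R.le_sq_inter_boxes hY hQ (fun i hi => (hZ i hi).1.le) (fun i hi => (hO i hi).1.le)
      hκ hZc hOc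
    have h2 : R.sq.real (E ∩ R.boxes n Q) ≤ R.sq.real (E ∩ D) + ε := by
      refine (measureReal_mono (s₂ := (E ∩ D) ∪ symmDiff D (R.boxes n Q)) ?_).trans
        ((measureReal_union_le _ _).trans (by linarith))
      rintro x ⟨hx, hx'⟩
      by_cases hxD : x ∈ D
      · exact Or.inl ⟨hx, hxD⟩
      · exact Or.inr (Or.inr ⟨hx', hxD⟩)
    have h3 : R.sq.real D ≤ R.sq.real (R.boxes n Q) + ε := by
      refine (measureReal_mono (s₂ := R.boxes n Q ∪ symmDiff D (R.boxes n Q)) ?_).trans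
        ((measureReal_union_le _ _).trans (by linarith))
      intro x hx
      by_cases hxD : x ∈ R.boxes n Q
      · exact Or.inl hxD
      · exact Or.inr (Or.inl ⟨hx, hxD⟩)
    have hSm : MeasurableSet (symmDiff A B) := hAm.symmDiff (R.measurableSet_boxes _ _)
    -- Translation by `v` preserves Lebesgue measure and sends `E` into the square of the space,
    -- where `R.sq` is Lebesgue measure.
    have h4 : R.sq (E ∩ (· + v) ⁻¹' symmDiff A B) ≤ R.sq (symmDiff A B) := by
      rw [R.sq_of_subset (Set.inter_subset_left.trans hEs), sq, Measure.restrict_apply hSm,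
        ← measure_preimage_add_right volume v (symmDiff A B ∩ R.space ×ˢ R.space)]
      refine measure_mono ?_
      rintro x ⟨hx, hx'⟩
      refine ⟨hx', ?_⟩
      obtain ⟨h1, h2⟩ := hx
      obtain ⟨i, hi, a, ha, h1⟩ := R.mem_subcolumns.mp h1
      obtain ⟨j, hj, b, hb, h2⟩ := R.mem_subcolumns.mp h2
      exact ⟨R.level_subset_space ha (R.add_width_mem_level (hZ i hi).1 ha h1),
        R.level_subset_space hb (R.add_width_mem_level (hO j hj).1 hb h2)⟩
    have h4' : R.sq.real (E ∩ (· + v) ⁻¹' symmDiff A B) ≤ R.sq.real (symmDiff A B) :=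
      ENNReal.toReal_mono (measure_ne_top _ _) h4
    -- On `E ∩ D` exactly one of `x`, `x + v` lies in `A`, while both or neither lie in `B`; so one
    -- of them lies in the symmetric difference of `A` and `B`.
    have h5 : R.sq.real (E ∩ D) ≤ ε + ε := by
      refine (measureReal_mono (s₂ := symmDiff A B ∪ (E ∩ (· + v) ⁻¹' symmDiff A B)) ?_).trans
        ((measureReal_union_le _ _).trans (by linarith))
      rintro x ⟨hx, hxD⟩
      have i1 := mem_iff_add_mem hA hZ hO hx
      have i2 := R.mem_boxes_add_iff hP (fun i hi => (hZ i hi).1) (fun i hi => (hO i hi).1) hx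
      rw [hD, Set.mem_symmDiff] at hxD
      simp only [Set.mem_union, Set.mem_inter_iff, Set.mem_symmDiff, Set.mem_preimage] at *
      change x + v ∈ B ↔ x ∈ B at i2
      tauto
    have : κ ^ 2 * R.sq.real D ≤ κ ^ 2 * (R.sq.real (R.boxes n Q) + ε) :=
      mul_le_mul_of_nonneg_left h3 (by positivity)
    nlinarith
  have h0 : κ ^ 2 * R.sq.real D ≤ 0 := by
    refine le_of_forall_pos_le_add fun δ hδ => ?_
    refine (key (δ / (3 + κ ^ 2)) (by positivity)).trans (le_of_eq ?_)
    field_simp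
    ring
  have : 0 ≤ R.sq.real D := measureReal_nonneg
  have : 0 < κ ^ 2 := by positivity
  nlinarith

/-- T × T moves a box one step along the diagonal, and id × T moves it one step in the second
coordinate. Going forwards or backwards along these steps connects every box with the bottom one. -/
theorem sq_inter_box_eq {A : Set (ℝ × ℝ)}
    (hA : Prod.map R.map R.map ⁻¹' A = A)
    (hA' : R.sq (symmDiff A (Prod.map id R.map ⁻¹' A)) = 0) {n : ℕ} {p : ℕ × ℕ}
    (h1 : p.1 < R.height n) (h2 : p.2 < R.height n) :
    R.sq.real (A ∩ R.box n p) = R.sq.real (A ∩ R.box n (0, 0)) := by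
  obtain ⟨a, b⟩ := p
  dsimp only at h1 h2
  have tr : ∀ {S S' : Set (ℝ × ℝ)} {a b a' b' : ℕ}, a < R.height n → b < R.height n →
      a' < R.height n → b' < R.height n →
      (∀ x ∈ R.box n (a, b), x ∈ S ↔
        x + (R.base n a' - R.base n a, R.base n b' - R.base n b) ∈ S') →
      R.sq.real (S ∩ R.box n (a, b)) = R.sq.real (S' ∩ R.box n (a', b')) := by
    intro S S' a b a' b' ha hb ha' hb' hx
    rw [measureReal_def, measureReal_def,
      R.sq_of_subset (Set.inter_subset_right.trans (R.box_subset ha hb)),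
      R.sq_of_subset (Set.inter_subset_right.trans (R.box_subset ha' hb')),
      ← measure_preimage_add_right volume (R.base n a' - R.base n a, R.base n b' - R.base n b)
        (S' ∩ R.box n (a', b'))]
    congr 2
    ext x
    have hb : x + (R.base n a' - R.base n a, R.base n b' - R.base n b) ∈ R.box n (a', b') ↔
        x ∈ R.box n (a, b) := by
      simp only [box, level, Set.mem_prod, Set.mem_Ico, Prod.fst_add, Prod.snd_add]
      constructor <;> rintro ⟨⟨_, _⟩, _, _⟩ <;> refine ⟨⟨?_, ?_⟩, ?_, ?_⟩ <;> linarith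
    rw [Set.mem_preimage, Set.mem_inter_iff, Set.mem_inter_iff, hb]
    exact and_congr_left (hx x)
  have up : ∀ {a b}, a + 1 < R.height n → b + 1 < R.height n →
      R.sq.real (A ∩ R.box n (a, b)) = R.sq.real (A ∩ R.box n (a + 1, b + 1)) := by
    intro a b ha hb
    refine tr (by omega) (by omega) ha hb fun x hx => ?_
    conv_lhs => rw [← hA]
    rw [Set.mem_preimage, Prod.map, R.map_eq ha hx.1, R.map_eq hb hx.2]
    rfl
  have right : ∀ {a b}, a < R.height n → b + 1 < R.height n →
      R.sq.real (A ∩ R.box n (a, b)) = R.sq.real (A ∩ R.box n (a, b + 1)) := by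
    intro a b ha hb
    have : R.sq.real (A ∩ R.box n (a, b)) =
        R.sq.real ((Prod.map id R.map ⁻¹' A) ∩ R.box n (a, b)) :=
      measureReal_congr ((measure_symmDiff_eq_zero_iff.mp hA').inter (ae_eq_refl _))
    rw [this]
    refine tr ha (by omega) ha hb fun x hx => ?_
    rw [Set.mem_preimage, Prod.map, R.map_eq hb hx.2, sub_self]
    have : x + (0, R.base n (b + 1) - R.base n b) =
        (id x.1, x.2 + (R.base n (b + 1) - R.base n b)) := by
      ext <;> simp
    rw [this]
  have right' : ∀ {a}, a < R.height n → ∀ {b}, b < R.height n →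
      R.sq.real (A ∩ R.box n (a, b)) = R.sq.real (A ∩ R.box n (a, 0)) := by
    intro a ha b hb
    induction b with
    | zero => rfl
    | succ b ih => rw [← right ha hb, ih (by omega)]
  rw [right' h1 h2]
  clear h2
  induction a with
  | zero => rfl
  | succ a ih => rw [← ih (by omega), right' (by omega) (b := 0) (by omega),
      up h1 (by omega : 0 + 1 < R.height n), ← right h1 (by omega)]

theorem ergodic_prod (hY : volume R.space ≠ ∞) {κ : ℝ} (hκ : 0 < κ)
    (h : ∀ᶠ n in atTop,
        κ * (R.r n + 1) ≤ (((Finset.range (R.r n)).filter fun i => R.s n i = 0).card : ℝ) ∧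
        κ * (R.r n + 1) ≤ (((Finset.range (R.r n)).filter fun i => R.s n i = 1).card : ℝ)) :
    Ergodic (Prod.map R.map R.map) (R.measure.prod R.measure) := by
  have := R.isFiniteMeasure_sq hY
  have := R.isProbabilityMeasure hY
  have hT := R.measurePreserving_map hY
  refine ⟨hT.prod hT, ⟨fun A hAm hA => ?_⟩⟩
  have hac : R.measure.prod R.measure ≪ R.sq := by
    have : R.measure ≪ volume.restrict R.space := by
      rw [measure_eq]
      exact Measure.smul_absolutelyContinuous
    rw [sq_eq]
    exact this.prod this
  suffices EventuallyConst A (ae R.sq) from this.anti hac.ae_le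
  have hD := sq_symmDiff_eq_zero hY hκ h hAm hA
  -- Both sides contain the two numbers of boxes as factors; cross-multiplication avoids dividing by
  -- a measure that may vanish.
  have hbox : ∀ U V : Set (ℝ × ℝ), ∀ n,
      R.sq.real (A ∩ R.boxes n (R.boxesIn n U)) * R.sq.real (R.boxes n (R.boxesIn n V)) =
      R.sq.real (A ∩ R.boxes n (R.boxesIn n V)) * R.sq.real (R.boxes n (R.boxesIn n U)) := by
    intro U V n
    have hP : ∀ U : Set (ℝ × ℝ), ∀ p ∈ R.boxesIn n U, p.1 < R.height n ∧ p.2 < R.height n := by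
      intro U p hp
      have := R.mem_boxesIn.mp hp
      exact ⟨this.1, this.2.1⟩
    have hs : ∀ U : Set (ℝ × ℝ), R.sq.real (A ∩ R.boxes n (R.boxesIn n U)) =
        (R.boxesIn n U).card * R.sq.real (A ∩ R.box n (0, 0)) := by
      intro U
      rw [R.sq_inter_boxes hY (hP U) hAm, Finset.sum_congr rfl fun p hp =>
        sq_inter_box_eq hA hD (hP U p hp).1 (hP U p hp).2]
      simp
    rw [hs, hs, R.sq_boxes hY (hP U), R.sq_boxes hY (hP V)]
    ring
  have hlim : ∀ {U : Set (ℝ × ℝ)}, IsOpen U → ∀ {S : Set (ℝ × ℝ)}, MeasurableSet S →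
      Tendsto (fun n => R.sq.real (S ∩ R.boxes n (R.boxesIn n U))) atTop
        (𝓝 (R.sq.real (S ∩ U))) := by
    intro U hU S hS
    have h := (ENNReal.tendsto_toReal (measure_ne_top _ _)).comp
      (R.tendsto_measure_boxesIn (R.sq.restrict S) hU)
    have e1 : (fun n => R.sq.real (S ∩ R.boxes n (R.boxesIn n U))) =
        ENNReal.toReal ∘ fun n => (R.sq.restrict S) (R.boxes n (R.boxesIn n U)) := by
      funext n
      rw [Function.comp, Measure.restrict_apply (R.measurableSet_boxes _ _), Set.inter_comm]
      rfl
    have e2 : R.sq.real (S ∩ U) = ((R.sq.restrict S) (U ∩ R.space ×ˢ R.space)).toReal := by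
      have hm := R.measurableSet_space.prod R.measurableSet_space
      rw [Measure.restrict_apply (hU.measurableSet.inter hm), sq, measureReal_def,
        Measure.restrict_apply (hS.inter hU.measurableSet),
        Measure.restrict_apply ((hU.measurableSet.inter hm).inter hS)]
      congr 2
      ext x
      simp only [Set.mem_inter_iff]
      tauto
    rw [e1, e2]
    exact h
  have hopen : ∀ U : Set (ℝ × ℝ), IsOpen U →
      R.sq.real (A ∩ U) * R.sq.real Set.univ = R.sq.real A * R.sq.real U := by
    intro U hU
    have l1 := (hlim hU hAm).mul (hlim isOpen_univ .univ)
    have l2 := (hlim isOpen_univ hAm).mul (hlim hU .univ)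
    simp only [Set.univ_inter, Set.inter_univ] at l1 l2
    exact tendsto_nhds_unique l1 (l2.congr fun n => (hbox U Set.univ n).symm)
  -- Apply `hopen` to open `U ⊇ A` of nearly the same measure: `A ∩ U = A`, so the total mass may be
  -- replaced by nearly the measure of `A`.
  have hA2 : R.sq.real A * R.sq.real Set.univ ≤ R.sq.real A * R.sq.real A := by
    have hV : 0 ≤ R.sq.real A := measureReal_nonneg
    refine le_of_forall_pos_le_add fun ε hε => ?_
    obtain ⟨U, hAU, hU, hlt⟩ := A.exists_isOpen_lt_add (μ := R.sq) (measure_ne_top _ _)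
      (ENNReal.ofReal_pos.mpr (div_pos hε (add_pos_of_nonneg_of_pos hV one_pos))).ne'
    have := hopen U hU
    rw [Set.inter_eq_left.mpr hAU] at this
    rw [this]
    have hlt' : R.sq.real U ≤ R.sq.real A + ε / (R.sq.real A + 1) := by
      have := ENNReal.toReal_mono (by finiteness) hlt.le
      rwa [ENNReal.toReal_add (measure_ne_top _ _) ENNReal.ofReal_ne_top,
        ENNReal.toReal_ofReal (by positivity)] at this
    calc _ ≤ R.sq.real A * (R.sq.real A + ε / (R.sq.real A + 1)) :=
          mul_le_mul_of_nonneg_left hlt' hV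
      _ = R.sq.real A * R.sq.real A + ε * (R.sq.real A / (R.sq.real A + 1)) := by ring
      _ ≤ _ := by
          have : R.sq.real A / (R.sq.real A + 1) ≤ 1 := by
            rw [div_le_one (by positivity)]; linarith
          nlinarith
  rw [eventuallyConst_set']
  rcases (measureReal_nonneg (μ := R.sq) (s := A)).eq_or_lt with h0 | h0
  · left
    exact ae_eq_empty.mpr ((measureReal_eq_zero_iff).mp h0.symm)
  · right
    rw [ae_eq_univ, ← measureReal_eq_zero_iff, measureReal_compl hAm]
    have := le_of_mul_le_mul_left hA2 h0
    have := measureReal_mono (μ := R.sq) (Set.subset_univ A)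
    linarith

theorem isWeaklyMixing_map (hY : volume R.space ≠ ∞) {κ : ℝ} (hκ : 0 < κ)
    (h : ∀ᶠ n in atTop,
        κ * (R.r n + 1) ≤ (((Finset.range (R.r n)).filter fun i => R.s n i = 0).card : ℝ) ∧
        κ * (R.r n + 1) ≤ (((Finset.range (R.r n)).filter fun i => R.s n i = 1).card : ℝ)) :
    IsWeaklyMixing R.map R.measure :=
  ⟨R.isProbabilityMeasure hY, R.measurePreserving_map hY, ergodic_prod hY hκ h⟩

/-! ### Finite measure and the special family of parameters -/

/-- A construction with bounded spacers lives on a space of finite measure. -/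
theorem volume_space_lt_top {k : ℕ} (hk : ∀ n, ∀ i ≤ R.r n, R.s n i ≤ k) :
    volume R.space < ∞ := by
  -- Stage `n` adds at most `k * R.width n`, and the widths are at most `(1 / 2) ^ n`; the bracket
  -- is the geometric sum.
  have key : ∀ n, R.height n * R.width n ≤ 1 + k * (2 - 2 * (1 / 2 : ℝ) ^ n) := by
    intro n
    induction n with
    | zero => simp [height, levels, width]
    | succ n ih =>
      have h1 : R.height (n + 1) ≤ (R.r n + 1) * (R.height n + k) := by
        rw [height_succ, offset]
        refine (Finset.sum_le_card_nsmul _ _ (R.height n + k) fun i hi => ?_).trans (by simp)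
        have := hk n i (by simpa [Nat.lt_succ_iff] using hi)
        omega
      have h1' : (R.height (n + 1) : ℝ) ≤ (R.r n + 1) * (R.height n + k) := by exact_mod_cast h1
      calc (R.height (n + 1) * R.width (n + 1) : ℝ)
          ≤ (R.r n + 1) * (R.height n + k) * R.width (n + 1) :=
            mul_le_mul_of_nonneg_right h1' (R.width_pos _).le
        _ = R.height n * R.width n + k * R.width n := by rw [R.width_eq n]; ring
        _ ≤ 1 + k * (2 - 2 * (1 / 2 : ℝ) ^ n) + k * (1 / 2) ^ n :=
            add_le_add ih (mul_le_mul_of_nonneg_left (R.width_le n) (Nat.cast_nonneg k))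
        _ = _ := by ring
  refine (le_of_tendsto' R.tendsto_volume_column fun n => ?_ : _ ≤ ENNReal.ofReal (1 + k * 2)).trans_lt
    ENNReal.ofReal_lt_top
  rw [volume_column]
  refine ENNReal.ofReal_le_ofReal ((key n).trans ?_)
  have : (k : ℝ) * (2 - 2 * (1 / 2 : ℝ) ^ n) ≤ k * 2 :=
    mul_le_mul_of_nonneg_left (by linarith [pow_pos (by norm_num : (0 : ℝ) < 1 / 2) n])
      (Nat.cast_nonneg k)
  linarith

/-- Each of the first `L n - 1` periods contributes one index of residue `γ n` (no spacer) and one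
of residue 0 (one spacer). The last period is dropped since its final index is `r n`, which is
outside the range. -/
theorem family_card (L γ : ℕ → ℕ) (hL : ∀ n, 1 < L n) (hγ : ∀ n, 1 < γ n) (n : ℕ) :
    L n - 1 ≤ ((Finset.range ((family L γ hL hγ).r n)).filter
      fun i => (family L γ hL hγ).s n i = 0).card ∧
    L n - 1 ≤ ((Finset.range ((family L γ hL hγ).r n)).filter
      fun i => (family L γ hL hγ).s n i = 1).card := by
  have hg := hγ n
  have hinj : ∀ c, Function.Injective fun l => l * (γ n + 1) + c := fun c l l' h => by
    simpa using h
  have hlt : ∀ l < L n - 1, ∀ c ≤ γ n, l * (γ n + 1) + c < L n * (γ n + 1) - 1 := by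
    intro l hl c hc
    have : (l + 2) * (γ n + 1) ≤ L n * (γ n + 1) := Nat.mul_le_mul_right _ (by omega)
    rw [add_mul] at this
    omega
  have aux : ∀ c ≤ γ n, ∀ e, (if c = γ n then 0 else 1) = e →
      L n - 1 ≤ ((Finset.range ((family L γ hL hγ).r n)).filter
        fun i => (family L γ hL hγ).s n i = e).card := by
    intro c hc e he
    calc L n - 1 = ((Finset.range (L n - 1)).image fun l => l * (γ n + 1) + c).card := by
          rw [Finset.card_image_of_injective _ (hinj c), Finset.card_range]
      _ ≤ _ := by
          refine Finset.card_le_card fun i hi => ?_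
          simp only [Finset.mem_image, Finset.mem_range] at hi
          obtain ⟨l, hl, rfl⟩ := hi
          refine Finset.mem_filter.mpr ⟨Finset.mem_range.mpr (hlt l hl c hc), ?_⟩
          simp only [family, Nat.mul_add_mod_self_right, Nat.mod_eq_of_lt (Nat.lt_succ_of_le hc)]
          exact he
  exact ⟨aux (γ n) le_rfl 0 (by simp), aux 0 (by omega) 1 (by simp; omega)⟩

theorem family_spacers (L γ : ℕ → ℕ) (hL : ∀ n, 1 < L n) (hγ : ∀ n, 1 < γ n)
    (hlim : limsup (fun n => (γ n : ℕ∞)) atTop < ⊤) :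
    ∃ κ : ℝ, 0 < κ ∧ ∀ᶠ n in atTop,
      κ * ((family L γ hL hγ).r n + 1) ≤ (((Finset.range ((family L γ hL hγ).r n)).filter
        fun i => (family L γ hL hγ).s n i = 0).card : ℝ) ∧
      κ * ((family L γ hL hγ).r n + 1) ≤ (((Finset.range ((family L γ hL hγ).r n)).filter
        fun i => (family L γ hL hγ).s n i = 1).card : ℝ) := by
  obtain ⟨G, hG⟩ := ENat.ne_top_iff_exists.mp hlim.ne
  -- Eventually `γ n ≤ G`, and `L n - 1 ≥ L n / 2`; this gives the constant.
  refine ⟨1 / (2 * (G + 1)), by positivity, ?_⟩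
  have hev : ∀ᶠ n in atTop, (γ n : ℕ∞) < ((G + 1 : ℕ) : ℕ∞) :=
    eventually_lt_of_limsup_lt (by rw [← hG]; exact_mod_cast Nat.lt_succ_self G)
  filter_upwards [hev] with n hn
  have hn' : γ n ≤ G := Nat.lt_succ_iff.mp (by exact_mod_cast hn)
  obtain ⟨h0, h1⟩ := family_card L γ hL hγ n
  have hr : (((family L γ hL hγ).r n : ℕ) : ℝ) + 1 = L n * (γ n + 1) := by
    have : (family L γ hL hγ).r n + 1 = L n * (γ n + 1) :=
      Nat.sub_add_cancel (Nat.mul_pos (by have := hL n; omega) (by omega))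
    exact_mod_cast this
  have hle : 1 / (2 * ((G : ℝ) + 1)) * (((family L γ hL hγ).r n : ℕ) + 1) ≤ ((L n - 1 : ℕ) : ℝ) := by
    have hL1 := hL n
    rw [hr, div_mul_eq_mul_div, one_mul, div_le_iff₀ (by positivity), Nat.cast_sub hL1.le]
    have e1 : (L n : ℝ) ≤ 2 * (L n - 1) := by
      have : (2 : ℝ) ≤ L n := by exact_mod_cast hL1
      linarith
    have e2 : (γ n : ℝ) + 1 ≤ G + 1 := by
      have : (γ n : ℝ) ≤ G := by exact_mod_cast hn'
      linarith
    calc (L n : ℝ) * (γ n + 1) ≤ 2 * (L n - 1) * (G + 1) :=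
          mul_le_mul e1 e2 (by positivity) (by linarith [(Nat.cast_nonneg (L n) : (0 : ℝ) ≤ L n)])
      _ = _ := by push_cast; ring
  exact ⟨hle.trans (by exact_mod_cast h0), hle.trans (by exact_mod_cast h1)⟩

theorem family_spacers_le (L γ : ℕ → ℕ) (hL : ∀ n, 1 < L n) (hγ : ∀ n, 1 < γ n) (n i : ℕ) :
    (family L γ hL hγ).s n i ≤ 1 := by
  simp only [family]
  split <;> omega

/-! ### Coding of points by the subshift -/

variable (R)

/-- The point `x` lies in the column `n`, and its `m`-th iterate in the level at height `l`. -/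
def Codes (x : ℝ) (m : ℤ) (n l : ℕ) : Prop :=
  l < R.height n ∧ ∃ j < R.height n, x ∈ R.level n j ∧ (l : ℤ) = j + m

open Classical in
/-- The coding of a point by its orbit: the symbol `0` stands for the initial column, the symbol `1`
for the spacers. -/
noncomputable def code (x : ℝ) (m : ℤ) : Fin 2 :=
  if ∃ n l, R.Codes x m n l ∧ (R.word n).getD l 0 = 1 then 1 else 0

variable {R}

/-- Both columns sit inside the higher-numbered one, where the height of `x` is unique and the words
are reproduced. -/
theorem Codes.getD_eq {x : ℝ} {m : ℤ} {n l n' l' : ℕ} (h : R.Codes x m n l)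
    (h' : R.Codes x m n' l') : (R.word n).getD l 0 = (R.word n').getD l' 0 := by
  obtain ⟨hl, j, hj, hx, e⟩ := h
  obtain ⟨hl', j', hj', hx', e'⟩ := h'
  obtain ⟨k, k1, k2, k3⟩ := R.mem_level_mono (le_max_left n n') hj hx
  obtain ⟨k', k1', k2', k3'⟩ := R.mem_level_mono (le_max_right n n') hj' hx'
  have := R.eq_of_mem_level (by omega) (by omega) k2 k2'
  rw [← k3 l hl, ← k3' l' hl']
  congr 1
  omega

theorem Codes.code_eq {x : ℝ} {m : ℤ} {n l : ℕ} (h : R.Codes x m n l) :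
    R.code x m = (R.word n).getD l 0 := by
  unfold code
  split_ifs with hx
  · obtain ⟨n', l', h', e⟩ := hx
    rw [h.getD_eq h', e]
  · have : (R.word n).getD l 0 ≠ 1 := fun e => hx ⟨n, l, h, e⟩
    generalize (R.word n).getD l 0 = c at this
    fin_cases c
    · rfl
    · exact absurd rfl this

variable (R)

theorem measurable_code : Measurable R.code := by
  refine measurable_pi_lambda _ fun m => ?_
  refine Measurable.ite ?_ measurable_const measurable_const
  have : {x | ∃ n l, R.Codes x m n l ∧ (R.word n).getD l 0 = 1} = ⋃ n, ⋃ l, ⋃ j,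
      ⋃ (_ : l < R.height n ∧ j < R.height n ∧ (l : ℤ) = j + m ∧ (R.word n).getD l 0 = 1),
        R.level n j := by
    ext x
    simp only [Codes, Set.mem_ofPred_eq, Set.mem_iUnion, exists_prop]
    constructor
    · rintro ⟨n, l, ⟨h1, j, h2, h3, h4⟩, h5⟩
      exact ⟨n, l, j, ⟨h1, h2, h4, h5⟩, h3⟩
    · rintro ⟨n, l, j, ⟨h1, h2, h4, h5⟩, h3⟩
      exact ⟨n, l, ⟨h1, j, h2, h3, h4⟩, h5⟩
  rw [this]
  exact .iUnion fun n => .iUnion fun l => .iUnion fun j => .iUnion fun _ => R.measurableSet_level n j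

/-- The set of the points that are arbitrarily far from the top and the bottom of the columns. -/
def deep : Set ℝ := ⋂ N : ℕ, ⋃ n, ⋃ j, ⋃ (_ : N ≤ j ∧ j + N < R.height n), R.level n j

theorem mem_deep {x : ℝ} : x ∈ R.deep ↔
    ∀ N, ∃ n j, N ≤ j ∧ j + N < R.height n ∧ x ∈ R.level n j := by
  simp only [deep, Set.mem_iInter, Set.mem_iUnion, exists_prop, and_assoc]

theorem measurableSet_deep : MeasurableSet R.deep :=
  .iInter fun _ => .iUnion fun n => .iUnion fun j => .iUnion fun _ => R.measurableSet_level n j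

theorem volume_space_diff_deep (hY : volume R.space ≠ ∞) : volume (R.space \ R.deep) = 0 := by
  rw [deep, Set.sdiff_iInter, measure_iUnion_null_iff]
  intro N
  have hlim := (ENNReal.Tendsto.sub (tendsto_const_nhds (x := volume R.space))
    R.tendsto_volume_column (Or.inl hY)).add
      (ENNReal.tendsto_ofReal (R.tendsto_width.const_mul (2 * N + 1 : ℝ)))
  rw [tsub_self, mul_zero, ENNReal.ofReal_zero, add_zero] at hlim
  refine le_antisymm (ge_of_tendsto' hlim fun n => ?_) zero_le
  -- The heights within `N` of the bottom or top: boundedly many levels, whose total measure tends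
  -- to 0.
  set P : Finset ℕ := (Finset.range (R.height n)).filter fun j => ¬ (N ≤ j ∧ j + N < R.height n)
  have hP : P.card ≤ 2 * N + 1 := by
    have : P ⊆ Finset.range N ∪ Finset.Ico (R.height n - N) (R.height n) := by
      intro j hj
      simp only [P, Finset.mem_filter, Finset.mem_range, Finset.mem_union, Finset.mem_Ico] at *
      omega
    refine (Finset.card_le_card this).trans ((Finset.card_union_le _ _).trans ?_)
    simp only [Finset.card_range, Nat.card_Ico]
    omega
  calc _ ≤ volume ((R.space \ R.column n) ∪ ⋃ j ∈ P, R.level n j) := by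
        refine measure_mono ?_
        rintro x ⟨hx, hx'⟩
        by_cases hc : x ∈ R.column n
        · obtain ⟨j, hj, hxj⟩ := R.mem_column.mp hc
          refine Or.inr (Set.mem_iUnion₂.mpr ⟨j, Finset.mem_filter.mpr
            ⟨Finset.mem_range.mpr hj, fun h => hx' ?_⟩, hxj⟩)
          exact Set.mem_iUnion.mpr ⟨n, Set.mem_iUnion₂.mpr ⟨j, h, hxj⟩⟩
        · exact Or.inl ⟨hx, hc⟩
    _ ≤ volume (R.space \ R.column n) + volume (⋃ j ∈ P, R.level n j) := measure_union_le _ _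
    _ ≤ _ := by
        refine add_le_add (le_of_eq ?_) ?_
        · exact measure_sdiff (R.column_subset_space n) (R.measurableSet_column n).nullMeasurableSet
            (ne_top_of_le_ne_top hY (measure_mono (R.column_subset_space n)))
        · rw [R.volume_biUnion_level fun j hj => Finset.mem_range.mp (Finset.mem_filter.mp hj).1]
          refine ENNReal.ofReal_le_ofReal (mul_le_mul_of_nonneg_right ?_ (R.width_pos n).le)
          exact_mod_cast hP

theorem ae_mem_deep (hY : volume R.space ≠ ∞) : ∀ᵐ x ∂(R.measure), x ∈ R.deep := by
  have h : ∀ᵐ x ∂(volume.restrict R.space), x ∈ R.deep := by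
    rw [ae_iff, Measure.restrict_apply' R.measurableSet_space]
    refine (congrArg volume ?_).trans (R.volume_space_diff_deep hY)
    ext x
    simp [and_comm]
  rw [measure_eq]
  exact Measure.ae_smul_measure h _

variable {R}

/-- A finite window around a deep point stays inside a single column, so it is a subword of that
column's word. -/
theorem code_mem_subshift {x : ℝ} (hx : x ∈ R.deep) : R.code x ∈ R.subshift := by
  intro a l
  obtain ⟨n, j, h1, h2, hxj⟩ := R.mem_deep.mp hx (a.natAbs + l)
  obtain ⟨b, hb⟩ : ∃ b : ℕ, (b : ℤ) = j + a := ⟨(j + a).toNat, by omega⟩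
  have hbl : b + l ≤ R.height n := by omega
  refine ⟨n, ?_⟩
  have : List.ofFn (fun i : Fin l => R.code x (a + (i : ℕ))) = ((R.word n).drop b).take l := by
    refine List.ext_getElem ?_ fun i hi hi' => ?_
    · simp only [List.length_ofFn, List.length_take, List.length_drop, length_word]
      omega
    · rw [List.length_ofFn] at hi
      have hc : R.Codes x (a + (i : ℕ)) n (b + i) := ⟨by omega, j, by omega, hxj, by push_cast; omega⟩
      rw [List.getElem_ofFn, hc.code_eq, List.getElem_take, List.getElem_drop]
      simp [length_word, show b + i < R.height n by omega]
  rw [this]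
  exact (List.take_prefix _ _).isInfix.trans (List.drop_suffix _ _).isInfix

theorem code_map {x : ℝ} (hx : x ∈ R.deep) (m : ℤ) : R.code (R.map x) m = R.code x (m + 1) := by
  obtain ⟨n, j, h1, h2, hxj⟩ := R.mem_deep.mp hx (m.natAbs + 2)
  obtain ⟨b, hb⟩ : ∃ b : ℕ, (b : ℤ) = j + (m + 1) := ⟨(j + (m + 1)).toNat, by omega⟩
  have c1 : R.Codes x (m + 1) n b := ⟨by omega, j, by omega, hxj, hb⟩
  have c2 : R.Codes (R.map x) m n b :=
    ⟨by omega, j + 1, by omega, R.map_mem_level (by omega) hxj, by push_cast; omega⟩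
  rw [c1.code_eq, c2.code_eq]

theorem nonempty_deep (hY : volume R.space ≠ ∞) : R.deep.Nonempty := by
  have := R.isProbabilityMeasure hY
  exact (R.ae_mem_deep hY).exists

variable (R)

open Classical in
/-- The coding as a map to the subshift. -/
noncomputable def coding (hY : volume R.space ≠ ∞) (x : ℝ) : R.subshift :=
  if h : x ∈ R.deep then ⟨R.code x, code_mem_subshift h⟩
  else ⟨R.code (nonempty_deep hY).some, code_mem_subshift (nonempty_deep hY).some_mem⟩

theorem coding_apply (hY : volume R.space ≠ ∞) {x : ℝ} (hx : x ∈ R.deep) :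
    (R.coding hY x).1 = R.code x := by
  rw [coding, dif_pos hx]

theorem measurable_coding (hY : volume R.space ≠ ∞) : Measurable (R.coding hY) := by
  classical
  have : R.coding hY = fun x => ⟨if x ∈ R.deep then R.code x else R.code (nonempty_deep hY).some, by
      split_ifs with h
      · exact code_mem_subshift h
      · exact code_mem_subshift (nonempty_deep hY).some_mem⟩ := by
    funext x
    unfold coding
    split_ifs <;> rfl
  rw [this]
  exact Measurable.subtype_mk (R.measurable_code.ite R.measurableSet_deep measurable_const)

theorem measurable_shift : Measurable R.shift := by
  refine Measurable.subtype_mk (measurable_pi_lambda _ fun m => ?_)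
  exact (measurable_pi_apply (m + 1)).comp measurable_subtype_coe

theorem coding_map (hY : volume R.space ≠ ∞) :
    R.coding hY ∘ R.map =ᵐ[R.measure] R.shift ∘ R.coding hY := by
  filter_upwards [R.ae_mem_deep hY,
    (R.measurePreserving_map hY).quasiMeasurePreserving.ae (R.ae_mem_deep hY)] with x hx hx'
  refine Subtype.ext (funext fun m => ?_)
  simp only [Function.comp, shift]
  rw [R.coding_apply hY hx', R.coding_apply hY hx, code_map hx]

end RankOneData

/-! ### Factors -/

/-- Weak mixing passes to factors. -/
theorem IsWeaklyMixing.factor {Y Z : Type*} [MeasurableSpace Y] [MeasurableSpace Z] {T : Y → Y}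
    {S : Z → Z} {μ : Measure Y} (h : IsWeaklyMixing T μ) {Φ : Y → Z} (hΦ : Measurable Φ)
    (hS : Measurable S) (hc : Φ ∘ T =ᵐ[μ] S ∘ Φ) : IsWeaklyMixing S (μ.map Φ) := by
  have hμ := h.isProbabilityMeasure
  have hν : IsProbabilityMeasure (μ.map Φ) := Measure.isProbabilityMeasure_map hΦ.aemeasurable
  have hSp : MeasurePreserving S (μ.map Φ) (μ.map Φ) := by
    refine ⟨hS, ?_⟩
    rw [Measure.map_map hS hΦ, ← Measure.map_congr hc, ← Measure.map_map hΦ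
      h.measurePreserving.measurable, h.measurePreserving.map_eq]
  have hmap : (μ.map Φ).prod (μ.map Φ) = (μ.prod μ).map (Prod.map Φ Φ) :=
    Measure.map_prod_map _ _ hΦ hΦ
  refine ⟨hν, hSp, hSp.prod hSp, ⟨fun A hAm hA => ?_⟩⟩
  have hΦ2 : Measurable (Prod.map Φ Φ) := hΦ.prodMap hΦ
  have hcc : ∀ᵐ p ∂μ.prod μ, Prod.map Φ Φ (Prod.map T T p) = Prod.map S S (Prod.map Φ Φ p) := by
    filter_upwards [Measure.quasiMeasurePreserving_fst.ae hc,
      Measure.quasiMeasurePreserving_snd.ae hc] with p h1 h2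
    exact Prod.ext h1 h2
  have hinv : Prod.map T T ⁻¹' (Prod.map Φ Φ ⁻¹' A) =ᵐ[μ.prod μ] Prod.map Φ Φ ⁻¹' A := by
    filter_upwards [hcc] with p hp
    refine propext ?_
    change Prod.map Φ Φ (Prod.map T T p) ∈ A ↔ Prod.map Φ Φ p ∈ A
    rw [hp]
    conv_rhs => rw [← hA]
    rfl
  -- The preimage is invariant only almost everywhere, as the intertwining is; hence the
  -- almost-everywhere form of ergodicity.
  have := h.ergodic_prod.quasiErgodic.aeconst_set₀ (hΦ2 hAm).nullMeasurableSet hinv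
  rw [eventuallyConst_set] at this ⊢
  rw [hmap]
  exact this.imp (ae_map_iff (p := fun x => x ∈ A) hΦ2.aemeasurable hAm).mpr
    (ae_map_iff (p := fun x => x ∉ A) hΦ2.aemeasurable hAm.compl).mpr

/-! ### Existence and uniqueness of the empirical measure -/

namespace RankOneData

variable (R : RankOneData)

theorem measurableSet_cylinder (w : List (Fin 2)) (a : ℤ) : MeasurableSet (R.cylinder w a) := by
  have : R.cylinder w a = ⋂ i : Fin w.length, {x | x.1 (a + (i : ℕ)) = w.get i} := by
    ext x
    simp [cylinder]
  rw [this]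
  refine .iInter fun i => ?_
  have hm : Measurable fun x : R.subshift => x.1 (a + (i : ℕ)) :=
    (measurable_pi_apply _).comp measurable_subtype_coe
  exact hm (measurableSet_singleton (w.get i))

theorem coding_mem_cylinder_iff (hY : volume R.space ≠ ∞) {x : ℝ} (hx : x ∈ R.deep) {n j : ℕ}
    {w : List (Fin 2)} (hj : j + w.length < R.height n) (hxj : x ∈ R.level n j) :
    R.coding hY x ∈ R.cylinder w 0 ↔ w <+: (R.word n).drop j := by
  have hc : ∀ i < w.length, R.code x (0 + (i : ℕ)) = (R.word n).getD (j + i) 0 := fun i hi =>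
    Codes.code_eq ⟨by omega, j, by omega, hxj, by push_cast; omega⟩
  change (∀ i : Fin w.length, (R.coding hY x).1 (0 + (i : ℕ)) = w.get i) ↔ _
  rw [R.coding_apply hY hx, List.prefix_iff_getElem?]
  have key : ∀ i (hi : i < w.length), R.code x (0 + (i : ℕ)) = w[i] ↔
      ((R.word n).drop j)[i]? = some w[i] := by
    intro i hi
    have hlt : j + i < (R.word n).length := by rw [length_word]; omega
    rw [hc i hi, List.getElem?_drop, List.getElem?_eq_getElem hlt, List.getD_eq_getElem _ _ hlt,
      Option.some_inj]
  exact ⟨fun h i hi => (key i hi).mp (h ⟨i, hi⟩), fun h i => (key i i.2).mpr (h i i.2)⟩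

/-- The frequency of a word in the columns approximates the measure of its cylinder. -/
theorem abs_occurrences_sub_le (hY : volume R.space ≠ ∞) (w : List (Fin 2)) (n : ℕ) :
    |occurrences w (R.word n) * R.width n -
        volume.real (R.coding hY ⁻¹' R.cylinder w 0 ∩ R.space)| ≤
      (volume.real R.space - R.height n * R.width n) + w.length * R.width n := by
  set C := R.coding hY ⁻¹' R.cylinder w 0 ∩ R.space
  set P := (Finset.range ((R.word n).length - w.length)).filter fun j => w <+: (R.word n).drop j
  have hocc : occurrences w (R.word n) = P.card := rfl
  have hw := (R.width_pos n).le
  have hP : ∀ j ∈ P, j + w.length < R.height n ∧ w <+: (R.word n).drop j := by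
    intro j hj
    simp only [P, Finset.mem_filter, Finset.mem_range, length_word] at hj
    exact ⟨by omega, hj.2⟩
  have real_levels : ∀ Q : Finset ℕ, (∀ j ∈ Q, j < R.height n) →
      volume.real (⋃ j ∈ Q, R.level n j) = Q.card * R.width n := by
    intro Q hQ
    rw [measureReal_def, R.volume_biUnion_level hQ, ENNReal.toReal_ofReal (by positivity)]
  have hPl := real_levels P fun j hj => by have := (hP j hj).1; omega
  have hcol : volume.real (R.space \ R.column n) =
      volume.real R.space - R.height n * R.width n := by
    rw [measureReal_sdiff' (R.measurableSet_column n) hY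
      (ne_top_of_le_ne_top hY (measure_mono (R.column_subset_space n))),
      Set.union_eq_self_of_subset_right (R.column_subset_space n), measureReal_def _ (R.column n),
      volume_column, ENNReal.toReal_ofReal (by positivity)]
  have hdeep : volume.real (R.space \ R.deep) = 0 := by
    rw [measureReal_def, R.volume_space_diff_deep hY, ENNReal.toReal_zero]
  have fin : ∀ {S : Set ℝ}, S ⊆ R.space → volume S ≠ ∞ := fun h =>
    ne_top_of_le_ne_top hY (measure_mono h)
  -- The topmost levels, which `occurrences` does not count as starting positions; they cause the
  -- error `w.length * R.width n`.
  set Q := Finset.Ico (R.height n - w.length) (R.height n)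
  have hQ : ∀ j ∈ Q, j < R.height n := fun j hj => (Finset.mem_Ico.mp hj).2
  have hQl := real_levels Q hQ
  have hQc : (Q.card : ℝ) ≤ w.length := by
    have : Q.card ≤ w.length := by rw [Nat.card_Ico]; omega
    exact_mod_cast this
  have hsub : ∀ Q : Finset ℕ, (∀ j ∈ Q, j < R.height n) → (⋃ j ∈ Q, R.level n j) ⊆ R.space :=
    fun Q hQ => Set.iUnion₂_subset fun j hj => R.level_subset_space (hQ j hj)
  have hPs := hsub P fun j hj => by have := (hP j hj).1; omega
  have hQs := hsub Q hQ
  have low : (P.card : ℝ) * R.width n ≤ volume.real C := by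
    rw [← hPl]
    refine (measureReal_mono (s₂ := C ∪ (R.space \ R.deep)) ?_
      (fin (Set.union_subset Set.inter_subset_right Set.sdiff_subset))).trans
      ((measureReal_union_le _ _).trans (by rw [hdeep, add_zero]))
    intro x hx
    have hxs := hPs hx
    simp only [Set.mem_iUnion, exists_prop] at hx
    obtain ⟨j, hj, hxj⟩ := hx
    by_cases hd : x ∈ R.deep
    · exact Or.inl ⟨(R.coding_mem_cylinder_iff hY hd (hP j hj).1 hxj).mpr (hP j hj).2, hxs⟩
    · exact Or.inr ⟨hxs, hd⟩
  have up : volume.real C ≤ P.card * R.width n + Q.card * R.width n +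
      (volume.real R.space - R.height n * R.width n) := by
    rw [← hPl, ← hQl, ← hcol]
    have h1 : C ⊆ (((⋃ j ∈ P, R.level n j) ∪ (⋃ j ∈ Q, R.level n j)) ∪ (R.space \ R.column n)) ∪
        (R.space \ R.deep) := by
      rintro x ⟨hx, hxs⟩
      by_cases hd : x ∈ R.deep
      · left
        by_cases hc : x ∈ R.column n
        · left
          obtain ⟨j, hj, hxj⟩ := R.mem_column.mp hc
          by_cases hjw : j + w.length < R.height n
          · refine Or.inl (Set.mem_iUnion₂.mpr ⟨j, Finset.mem_filter.mpr ⟨?_, ?_⟩, hxj⟩)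
            · rw [length_word, Finset.mem_range]; omega
            · exact (R.coding_mem_cylinder_iff hY hd hjw hxj).mp hx
          · exact Or.inr (Set.mem_iUnion₂.mpr ⟨j, Finset.mem_Ico.mpr ⟨by omega, hj⟩, hxj⟩)
        · exact Or.inr ⟨hxs, hc⟩
      · exact Or.inr ⟨hxs, hd⟩
    have i1 := measureReal_mono h1 (fin (Set.union_subset (Set.union_subset
      (Set.union_subset hPs hQs) Set.sdiff_subset) Set.sdiff_subset))
    have i2 := measureReal_union_le (μ := volume) (((⋃ j ∈ P, R.level n j) ∪ (⋃ j ∈ Q, R.level n j)) ∪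
      (R.space \ R.column n)) (R.space \ R.deep)
    have i3 := measureReal_union_le (μ := volume) ((⋃ j ∈ P, R.level n j) ∪ (⋃ j ∈ Q, R.level n j))
      (R.space \ R.column n)
    have i4 := measureReal_union_le (μ := volume) (⋃ j ∈ P, R.level n j) (⋃ j ∈ Q, R.level n j)
    linarith
  have hc0 : 0 ≤ volume.real R.space - R.height n * R.width n := hcol ▸ measureReal_nonneg
  have := mul_le_mul_of_nonneg_right hQc hw
  have h0 : 0 ≤ (w.length : ℝ) * R.width n := by positivity
  rw [hocc, abs_le]
  constructor <;> linarith

/-- Multiplying numerator and denominator by the width turns counts of levels into measures. -/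
theorem tendsto_frequency (hY : volume R.space ≠ ∞) (w : List (Fin 2)) :
    Tendsto (fun n => (occurrences w (R.word n) : ℝ) / ((R.word n).length - w.length : ℝ)) atTop
      (𝓝 ((R.measure.map (R.coding hY)).real (R.cylinder w 0))) := by
  have hV : volume.real R.space ≠ 0 := (measureReal_ne_zero_iff hY).mpr R.volume_space_ne_zero
  have hhw := R.tendsto_height_mul_width hY
  have hlw : Tendsto (fun n => (w.length : ℝ) * R.width n) atTop (𝓝 0) := by
    simpa using R.tendsto_width.const_mul (w.length : ℝ)
  have h1 : Tendsto (fun n => occurrences w (R.word n) * R.width n) atTop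
      (𝓝 (volume.real (R.coding hY ⁻¹' R.cylinder w 0 ∩ R.space))) := by
    rw [tendsto_iff_dist_tendsto_zero]
    refine squeeze_zero (fun _ => dist_nonneg) (R.abs_occurrences_sub_le hY w) ?_
    simpa using (hhw.const_sub (volume.real R.space)).add hlw
  have h2 := h1.div (hhw.sub hlw) (by simpa using hV)
  have e : (R.measure.map (R.coding hY)).real (R.cylinder w 0) =
      volume.real (R.coding hY ⁻¹' R.cylinder w 0 ∩ R.space) / (volume.real R.space - 0) := by
    have hm := R.measurable_coding hY (R.measurableSet_cylinder w 0)
    rw [measureReal_def, Measure.map_apply (R.measurable_coding hY) (R.measurableSet_cylinder w 0),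
      measure_eq, Measure.smul_apply, Measure.restrict_apply hm, smul_eq_mul, ENNReal.toReal_mul,
      ENNReal.toReal_inv, sub_zero, div_eq_inv_mul]
    rfl
  rw [e]
  refine h2.congr fun n => ?_
  have hw := (R.width_pos n).ne'
  rw [length_word, Pi.div_apply, ← sub_mul, mul_div_mul_right _ _ hw]

/-- Frequencies give the cylinders at position 0; shift invariance transports this to every
position. -/
theorem isEmpiricalMeasure_map_coding (hY : volume R.space ≠ ∞)
    (hs : MeasurePreserving R.shift (R.measure.map (R.coding hY)) (R.measure.map (R.coding hY))) :
    R.IsEmpiricalMeasure (R.measure.map (R.coding hY)) := by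
  have := R.isProbabilityMeasure hY
  refine ⟨Measure.isProbabilityMeasure_map (R.measurable_coding hY).aemeasurable, fun w a => ?_⟩
  have hsucc : ∀ a : ℤ, (R.measure.map (R.coding hY)).real (R.cylinder w (a + 1)) =
      (R.measure.map (R.coding hY)).real (R.cylinder w a) := by
    intro a
    rw [measureReal_def, measureReal_def,
      ← hs.measure_preimage (R.measurableSet_cylinder w a).nullMeasurableSet]
    congr 2
    ext x
    simp only [cylinder, shift, Set.mem_preimage, Set.mem_ofPred_eq]
    refine forall_congr' fun i => ?_
    rw [add_right_comm]
  have h0 : (R.measure.map (R.coding hY)).real (R.cylinder w a) =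
      (R.measure.map (R.coding hY)).real (R.cylinder w 0) := by
    induction a using Int.induction_on with
    | zero => rfl
    | succ i ih => rw [hsucc, ih]
    | pred i ih => rw [← ih, ← hsucc, sub_add_cancel]
  rw [h0]
  exact R.tendsto_frequency hY w

variable {R}

/-- Both measures give a cylinder the same limit. Cylinders are the atoms of finite windows, so all
finite-dimensional marginals agree. -/
theorem IsEmpiricalMeasure.unique {ν ν' : Measure R.subshift} (h : R.IsEmpiricalMeasure ν)
    (h' : R.IsEmpiricalMeasure ν') : ν = ν' := by
  have := h.isProbabilityMeasure
  have := h'.isProbabilityMeasure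
  have hcyl : ∀ w a, ν (R.cylinder w a) = ν' (R.cylinder w a) := fun w a =>
    (measureReal_eq_measureReal_iff).mp (tendsto_nhds_unique (h.tendsto w a) (h'.tendsto w a))
  have hval : Measurable (Subtype.val : R.subshift → ℤ → Fin 2) := measurable_subtype_coe
  have hwin : ∀ (a : ℤ) (l : ℕ),
      (ν.map Subtype.val).map (fun (x : ℤ → Fin 2) (i : Fin l) => x (a + (i : ℕ))) =
      (ν'.map Subtype.val).map (fun (x : ℤ → Fin 2) (i : Fin l) => x (a + (i : ℕ))) := by
    intro a l
    have hm : Measurable fun (x : ℤ → Fin 2) (i : Fin l) => x (a + (i : ℕ)) :=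
      measurable_pi_lambda _ fun i => measurable_pi_apply _
    refine Measure.ext_of_singleton fun u => ?_
    have hpre : Subtype.val ⁻¹' ((fun (x : ℤ → Fin 2) (i : Fin l) => x (a + (i : ℕ))) ⁻¹' {u}) =
        R.cylinder (List.ofFn u) a := by
      ext x
      simp only [Set.mem_preimage, Set.mem_singleton_iff, cylinder, Set.mem_ofPred_eq, funext_iff]
      constructor
      · intro hx i
        have hi : (i : ℕ) < l := by simpa using i.2
        rw [List.get_eq_getElem, List.getElem_ofFn]
        exact hx ⟨i, hi⟩
      · intro hx i
        have := hx ⟨i, by simp⟩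
        rwa [List.get_eq_getElem, List.getElem_ofFn] at this
    rw [Measure.map_apply hm (measurableSet_singleton u), Measure.map_apply hm
      (measurableSet_singleton u), Measure.map_apply hval (hm (measurableSet_singleton u)),
      Measure.map_apply hval (hm (measurableSet_singleton u)), hpre, hcyl]
  have hprob : IsProbabilityMeasure (ν.map Subtype.val) :=
    Measure.isProbabilityMeasure_map hval.aemeasurable
  have heq : ν.map Subtype.val = ν'.map (Subtype.val : R.subshift → ℤ → Fin 2) := by
    have : ∀ I : Finset ℤ, IsFiniteMeasure ((ν.map Subtype.val).map I.restrict) := fun I =>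
      inferInstance
    refine IsProjectiveLimit.unique (P := fun I => (ν.map Subtype.val).map I.restrict)
      (fun I => rfl) fun I => ?_
    set N := I.sup Int.natAbs
    have hN : ∀ m ∈ I, m.natAbs ≤ N := fun m hm => Finset.le_sup (f := Int.natAbs) hm
    -- The coordinates in `I` are read off from the window `[-N, N]`, whose distribution is known by
    -- `hwin`.
    set g : (Fin (2 * N + 1) → Fin 2) → (I → Fin 2) := fun u m =>
      u ⟨(m.1 + N).toNat, by have := hN m.1 m.2; omega⟩
    have hg : Measurable g := measurable_pi_lambda _ fun m => measurable_pi_apply _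
    have hm : Measurable fun (x : ℤ → Fin 2) (i : Fin (2 * N + 1)) => x (-N + (i : ℕ)) :=
      measurable_pi_lambda _ fun i => measurable_pi_apply _
    have hgr : I.restrict = g ∘ fun (x : ℤ → Fin 2) (i : Fin (2 * N + 1)) => x (-N + (i : ℕ)) := by
      funext x m
      have := hN m.1 m.2
      simp only [Finset.restrict, Function.comp, g]
      congr 1
      omega
    dsimp only
    rw [hgr, ← Measure.map_map hg hm, ← Measure.map_map hg hm, hwin]
  ext S hS
  obtain ⟨T, hT, rfl⟩ := hS
  rw [← Measure.map_apply hval hT, ← Measure.map_apply hval hT, heq]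

end RankOneData

theorem theorem5p1 :
    (∀ (R : RankOneData) (κ : ℝ), 0 < κ →
      (∀ᶠ n in atTop,
        κ * (R.r n + 1) ≤ (((Finset.range (R.r n)).filter fun i => R.s n i = 0).card : ℝ) ∧
        κ * (R.r n + 1) ≤ (((Finset.range (R.r n)).filter fun i => R.s n i = 1).card : ℝ)) →
      ((∃ k : ℕ, ∀ n, ∀ i ≤ R.r n, R.s n i ≤ k) →
        volume R.space < ∞ ∧ IsWeaklyMixing R.map R.measure) ∧
      ((∃ k : ℕ, ∀ n, ∀ i < R.r n, R.s n i ≤ k) → volume R.space < ∞ →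
        IsWeaklyMixing R.map R.measure)) ∧
    (∀ (L γ : ℕ → ℕ) (hL : ∀ n, 1 < L n) (hγ : ∀ n, 1 < γ n),
      limsup (fun n => (γ n : ℕ∞)) atTop < ⊤ →
      (volume (RankOneData.family L γ hL hγ).space < ∞ ∧
        IsWeaklyMixing (RankOneData.family L γ hL hγ).map
          (RankOneData.family L γ hL hγ).measure) ∧
      (∃! ν, (RankOneData.family L γ hL hγ).IsEmpiricalMeasure ν) ∧
      ∀ ν, (RankOneData.family L γ hL hγ).IsEmpiricalMeasure ν →
        IsWeaklyMixing (RankOneData.family L γ hL hγ).shift ν) := by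
  refine ⟨fun R κ hκ h => ⟨fun ⟨k, hk⟩ => ?_, fun _ hY =>
    RankOneData.isWeaklyMixing_map hY.ne hκ h⟩, fun L γ hL hγ hlim => ?_⟩
  · have hY := RankOneData.volume_space_lt_top hk
    exact ⟨hY, RankOneData.isWeaklyMixing_map hY.ne hκ h⟩
  · obtain ⟨κ, hκ, h⟩ := RankOneData.family_spacers L γ hL hγ hlim
    have hY := RankOneData.volume_space_lt_top
      fun n i _ => RankOneData.family_spacers_le L γ hL hγ n i
    have hmix := RankOneData.isWeaklyMixing_map hY.ne hκ h
    generalize RankOneData.family L γ hL hγ = R at *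
    have hshift := hmix.factor (R.measurable_coding hY.ne) R.measurable_shift (R.coding_map hY.ne)
    have hemp := R.isEmpiricalMeasure_map_coding hY.ne hshift.measurePreserving
    exact ⟨⟨hY, hmix⟩, ⟨_, hemp, fun ν hν => hν.unique hemp⟩, fun ν hν => hν.unique hemp ▸ hshift⟩
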